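/- Let $X$ be a discrete set, $m:X\to(0,\infty)$, and $\ell^r=\ell^r(X,m)$ ($1\le r\le\infty$) the associated complex weighted spaces. Let $b:X\times X\to[0,\infty)$ be symmetric with zero diagonal and $\sum_{y}b(x,y)<\infty$ for all $x$, let $o:X\times X\to\{z\in\mathbb C: |z|=1\}$ satisfy $o(x,y)=\overline{o(y,x)}$, and let $c:X\to\mathbb R$. Put $F=\{f:X\to\mathbb C\mid \sum_y b(x,y)|f(y)|<\infty \text{ for all } x\}$ and, for $f\in F$, $$\mathcal Hf(x)=\frac1{m(x)}\sum_{y\in X}b(x,y)\bigl(f(x)-o(x,y)f(y)\bigr)+\frac{c(x)}{m(x)}f(x).$$ On the space $C_c(X)$ of finitely supported functions let $$Q(\varphi,\psi)=\frac12\sum_{x,y}b(x,y)\bigl(\varphi(x)-o(x,y)\varphi(y)\bigr)\overline{\bigl(\psi(x)-o(x,y)\psi(y)\bigr)}+\sum_x c(x)\varphi(x)\overline{\psi(x)},$$ and assume that $Q$ is positive and closable on $\ell^2$. Let $H_2$ be the positive self-adjoint operator on $\ell^2$ associated with the closure of $Q$, and $S_2(t)=e^{-tH_2}$, $t\ge0$,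 the strongly continuous semigroup on $\ell^2$ with generator $-H_2$. For $1\le r<\infty$, if there is a strongly continuous semigroup $S_r$ on $\ell^r$ with $S_r(t)=S_2(t)$ on $\ell^r\cap\ell^2$ for all $t\ge0$, we say that $H_r$ exists and let $-H_r$ be the generator of $S_r$. We say that $H_\infty$ exists if $H_1$ does, and let $H_\infty=(H_1)^*$ be the adjoint with respect to the pairing $\langle f,g\rangle=\sum_x m(x)f(x)\overline{g(x)}$ of $\ell^1$ and $\ell^\infty$. **Theorem.** Let $p,q\in[1,\infty]$ with $\frac1p+\frac1q=1$. 1. If $b$ is locally finite, i.e. $\{y : b(x,y)>0\}$ is finite for every $x$, then $\mathcal HC_c(X)\subseteq\ell^q\cap\ell^2$. 2. Assume that $\mathcal HC_c(X)\subseteq\ell^q\cap\ell^2$ and that $H_p$ exists. Then $D(H_p)\subseteq F$ and $H_pf=\mathcal Hf$ for all $f\in D(H_p)$. Moreover, $H_q$ exists and $C_c(X)\subseteq D(H_q)$. -/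

import Mathlib

open MeasureTheory Filter Topology
open scoped ENNReal NNReal ComplexConjugate

noncomputable section

/-! ### Strongly continuous semigroups and their generators -/

/-- `S : [0,∞) → B(E)` is a strongly continuous semigroup of bounded operators. -/
structure IsC0Semigroup {E : Type*} [NormedAddCommGroup E] [NormedSpace ℂ E]
    (S : ℝ≥0 → E →L[ℂ] E) : Prop where
  map_zero : S 0 = ContinuousLinearMap.id ℂ E
  map_add : ∀ s t : ℝ≥0, S (s + t) = (S s).comp (S t)
  continuous_orbit : ∀ f : E, Continuous fun t => S t f

/-- The difference quotient `(S t f - f) / t`. -/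
def semigroupQuotient {E : Type*} [NormedAddCommGroup E] [NormedSpace ℂ E]
    (S : ℝ≥0 → E →L[ℂ] E) (f : E) (t : ℝ≥0) : E :=
  ((t : ℝ) : ℂ)⁻¹ • (S t f - f)

/-- The generator `A f = lim_{t → 0+} (S t f - f) / t` of `S`, defined on all `f` for which the
limit exists in norm. -/
def semigroupGenerator {E : Type*} [NormedAddCommGroup E] [NormedSpace ℂ E]
    (S : ℝ≥0 → E →L[ℂ] E) : E →ₗ.[ℂ] E where
  domain :=
    { carrier := {f | ∃ g, Tendsto (semigroupQuotient S f) (𝓝[>] 0) (𝓝 g)}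
      zero_mem' := ⟨0, by
        have : semigroupQuotient S (0 : E) = fun _ => 0 := by
          funext t; simp [semigroupQuotient]
        rw [this]; exact tendsto_const_nhds⟩
      add_mem' := by
        rintro f₁ f₂ ⟨g₁, h₁⟩ ⟨g₂, h₂⟩
        refine ⟨g₁ + g₂, (h₁.add h₂).congr fun t => ?_⟩
        simp only [semigroupQuotient, map_add, ← smul_add]
        congr 1; abel
      smul_mem' := by
        rintro a f ⟨g, h⟩
        refine ⟨a • g, (h.const_smul a).congr fun t => ?_⟩
        simp only [semigroupQuotient, map_smul, ← smul_sub]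
        rw [smul_comm] }
  toFun :=
    { toFun := fun f => f.2.choose
      map_add' := by
        intro f₁ f₂
        refine tendsto_nhds_unique (f₁ + f₂).2.choose_spec
          ((f₁.2.choose_spec.add f₂.2.choose_spec).congr fun t => ?_)
        simp only [semigroupQuotient, Submodule.coe_add, map_add, ← smul_add]
        congr 1; abel
      map_smul' := by
        intro a f
        refine tendsto_nhds_unique (a • f).2.choose_spec
          ((f.2.choose_spec.const_smul a).congr fun t => ?_)
        simp only [semigroupQuotient, Submodule.coe_smul, map_smul, ← smul_sub]
        rw [smul_comm] }

/-! ### Magnetic Schrödinger graphs -/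

/-- A magnetic Schrödinger graph `(b, o, c)` over a discrete measure space `(X, m)`. -/
structure MagneticSchrodingerGraph (X : Type*) where
  /-- the weights of the vertices -/
  m : X → ℝ
  /-- the edge weights -/
  b : X → X → ℝ
  /-- the magnetic potential -/
  o : X → X → ℂ
  /-- the electric potential -/
  c : X → ℝ
  m_pos : ∀ x, 0 < m x
  b_nonneg : ∀ x y, 0 ≤ b x y
  b_symm : ∀ x y, b x y = b y x
  b_diag : ∀ x, b x x = 0
  b_summable : ∀ x, Summable fun y => b x y
  o_norm : ∀ x y, ‖o x y‖ = 1
  o_symm : ∀ x y, o x y = conj (o y x)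

namespace MagneticSchrodingerGraph

variable {X : Type*}

/-- Every vertex has finitely many neighbours. -/
def LocallyFinite (G : MagneticSchrodingerGraph X) : Prop :=
  ∀ x, {y | 0 < G.b x y}.Finite

/-- The space `F` of functions to which the formal operator can be applied. -/
def formalDomain (G : MagneticSchrodingerGraph X) : Set (X → ℂ) :=
  {f | ∀ x, Summable fun y => G.b x y * ‖f y‖}

/-- The formal magnetic Schrödinger operator
`𝓗 f (x) = 1/m(x) ∑_y b(x,y) (f(x) - o(x,y) f(y)) + c(x)/m(x) f(x)`. -/
def formalOperator (G : MagneticSchrodingerGraph X) (f : X → ℂ) (x : X) : ℂ :=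
  1 / (G.m x : ℂ) * ∑' y, (G.b x y : ℂ) * (f x - G.o x y * f y)
    + 1 / (G.m x : ℂ) * (G.c x : ℂ) * f x

/-- The magnetic difference `∇ₒ f (x, y) = f(x) - o(x,y) f(y)`. -/
def magneticDiff (G : MagneticSchrodingerGraph X) (f : X → ℂ) (x y : X) : ℂ :=
  f x - G.o x y * f y

/-- The sesquilinear form `Q(φ, ψ)` on finitely supported functions. -/
def form (G : MagneticSchrodingerGraph X) (φ ψ : X →₀ ℂ) : ℂ :=
  1 / 2 * (∑' z : X × X,
      (G.b z.1 z.2 : ℂ) * G.magneticDiff φ z.1 z.2 * conj (G.magneticDiff ψ z.1 z.2))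
    + ∑' x, (G.c x : ℂ) * φ x * conj (ψ x)

/-- `Q(φ) = Q(φ, φ)`, which is always a real number. -/
def quadForm (G : MagneticSchrodingerGraph X) (φ : X →₀ ℂ) : ℝ := (G.form φ φ).re

/-- `Q` is positive: `Q(φ) ≥ 0` for all finitely supported `φ`. -/
def FormPositive (G : MagneticSchrodingerGraph X) : Prop := ∀ φ : X →₀ ℂ, 0 ≤ G.quadForm φ

/-- The pairing `∑_x m(x) f(x) conj(g(x))`. -/
def pairing (G : MagneticSchrodingerGraph X) (f g : X → ℂ) : ℂ :=
  ∑' x, (G.m x : ℂ) * f x * conj (g x)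

variable [MeasurableSpace X]

/-- The measure `m(A) = ∑_{x ∈ A} m(x)`. -/
def measure (G : MagneticSchrodingerGraph X) : Measure X :=
  Measure.sum fun x => ENNReal.ofReal (G.m x) • Measure.dirac x

/-- The Banach space `ℓ^p(X, m)`. The only null set of `G.measure` is the empty set, so that its
elements are functions on `X`. -/
abbrev ell (G : MagneticSchrodingerGraph X) (p : ℝ≥0∞) : Type _ := Lp ℂ p G.measure

variable [DiscreteMeasurableSpace X]

theorem memLp_finsupp (G : MagneticSchrodingerGraph X) (p : ℝ≥0∞) (φ : X →₀ ℂ) :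
    MemLp φ p G.measure := by
  classical
  have hfin : ∀ a : X, G.measure {a} ≠ ∞ := by
    intro a
    rw [measure, Measure.sum_apply _ (MeasurableSet.of_discrete),
      tsum_eq_single a (fun x hx => by simp [hx])]
    simp
  induction φ using Finsupp.induction_linear with
  | zero => simp
  | add f g hf hg => simpa using hf.add hg
  | single a z =>
    have h := memLp_indicator_const (μ := G.measure) p (MeasurableSet.of_discrete (s := {a})) z
      (Or.inr (hfin a))
    convert h using 1
    funext x
    by_cases hx : x = a
    · simp [hx]
    · simp [hx]

/-- The inclusion of `C_c(X)` into `ℓ^p(X, m)`. -/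
def ccToLp (G : MagneticSchrodingerGraph X) (p : ℝ≥0∞) (φ : X →₀ ℂ) : G.ell p :=
  (G.memLp_finsupp p φ).toLp φ

/-- `𝓗 C_c(X) ⊆ ℓ^q ∩ ℓ^2`. -/
def MapsCcInto (G : MagneticSchrodingerGraph X) (q : ℝ≥0∞) : Prop :=
  ∀ φ : X →₀ ℂ,
    MemLp (G.formalOperator φ) q G.measure ∧ MemLp (G.formalOperator φ) 2 G.measure

/-! ### The closure of the form and the operator on `ℓ^2` -/

/-- The sequence `φ` in `C_c(X)` is Cauchy for `Q` and converges to `f` in `ℓ^2`. -/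
def IsFormApprox (G : MagneticSchrodingerGraph X) (φ : ℕ → X →₀ ℂ) (f : G.ell 2) : Prop :=
  Tendsto (fun n => G.ccToLp 2 (φ n)) atTop (𝓝 f) ∧
    Tendsto (fun k : ℕ × ℕ => G.quadForm (φ k.1 - φ k.2)) atTop (𝓝 0)

/-- `Q` is closable on `ℓ^2`. -/
def FormClosable (G : MagneticSchrodingerGraph X) : Prop :=
  ∀ φ : ℕ → X →₀ ℂ, G.IsFormApprox φ 0 → Tendsto (fun n => G.quadForm (φ n)) atTop (𝓝 0)

/-- The domain `D(Q)` of the closure of `Q`. -/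
def closedFormDomain (G : MagneticSchrodingerGraph X) : Set (G.ell 2) :=
  {f | ∃ φ, G.IsFormApprox φ f}

/-- The closure of `Q` takes the value `a` at `(f, g)`: the value is the limit of `Q(φ_n, ψ_n)`
along approximating sequences. For positive closable `Q` there is exactly one such `a` for
`f, g ∈ D(Q)`. -/
def HasClosedFormValue (G : MagneticSchrodingerGraph X) (f g : G.ell 2) (a : ℂ) : Prop :=
  ∃ φ ψ, G.IsFormApprox φ f ∧ G.IsFormApprox ψ g ∧
    Tendsto (fun n => G.form (φ n) (ψ n)) atTop (𝓝 a)

/-- The graph of the operator `H = H_2` on `ℓ^2` associated to the closure of `Q`: `f ∈ D(H)` and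
`H f = h` if and only if `f ∈ D(Q)` and `Q(f, g) = ⟨h, g⟩` for all `g ∈ D(Q)`. Here `⟨h, g⟩ = ∑ m h conj(g)`
is `inner ℂ g h`. -/
def operatorGraph (G : MagneticSchrodingerGraph X) : Set (G.ell 2 × G.ell 2) :=
  {k | k.1 ∈ G.closedFormDomain ∧
    ∀ g ∈ G.closedFormDomain, G.HasClosedFormValue k.1 g (inner ℂ g k.2)}

/-- `S₂` is the semigroup `S₂(t) = e^{-tH}`, that is, the strongly continuous semigroup on `ℓ^2`
whose generator is `-H`. -/
def IsSchrodingerSemigroup (G : MagneticSchrodingerGraph X)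
    (S₂ : ℝ≥0 → G.ell 2 →L[ℂ] G.ell 2) : Prop :=
  IsC0Semigroup S₂ ∧
    ∀ f h : G.ell 2, (f, h) ∈ (-semigroupGenerator S₂).graph ↔ (f, h) ∈ G.operatorGraph

/-! ### The operators `H_p` on `ℓ^p` -/

/-- `S` is a strongly continuous semigroup on `ℓ^p` that agrees with `S₂` on `ℓ^2 ∩ ℓ^p`. -/
def IsConsistentSemigroup (G : MagneticSchrodingerGraph X)
    (S₂ : ℝ≥0 → G.ell 2 →L[ℂ] G.ell 2) (p : ℝ≥0∞) [Fact (1 ≤ p)]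
    (S : ℝ≥0 → G.ell p →L[ℂ] G.ell p) : Prop :=
  IsC0Semigroup S ∧
    ∀ (t : ℝ≥0) (f : G.ell 2) (g : G.ell p),
      (∀ x, (f : X → ℂ) x = (g : X → ℂ) x) →
        ∀ x, (S₂ t f : X → ℂ) x = (S t g : X → ℂ) x

/-- `H` is the adjoint of the operator `H₁` on `ℓ^1` with respect to the pairing
`∑_x m(x) f(x) conj(g(x))`, with its full domain (used for `p = ∞`, where this pairing identifies
`ℓ^∞` with the dual of `ℓ^1`): `f ∈ D(H)` and `H f = h` if and only if `⟨H₁ g, f⟩ = ⟨g, h⟩` for all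
`g ∈ D(H₁)`. -/
def IsAdjointOfL1 (G : MagneticSchrodingerGraph X) (p : ℝ≥0∞) [Fact (1 ≤ p)]
    (H₁ : G.ell 1 →ₗ.[ℂ] G.ell 1) (H : G.ell p →ₗ.[ℂ] G.ell p) : Prop :=
  ∀ f h : G.ell p, (f, h) ∈ H.graph ↔
    ∀ g : H₁.domain, G.pairing (H₁ g) f = G.pairing (g : G.ell 1) h

/-- `H = H_p` for `p < ∞`: `-H` is the generator of a strongly continuous semigroup on `ℓ^p`
consistent with `S₂`. -/
def IsLpGeneratorFinite (G : MagneticSchrodingerGraph X)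
    (S₂ : ℝ≥0 → G.ell 2 →L[ℂ] G.ell 2) (p : ℝ≥0∞) [Fact (1 ≤ p)]
    (H : G.ell p →ₗ.[ℂ] G.ell p) : Prop :=
  ∃ S : ℝ≥0 → G.ell p →L[ℂ] G.ell p,
    G.IsConsistentSemigroup S₂ p S ∧ H = -semigroupGenerator S

/-- `H = H_p` for `p ∈ [1, ∞]`. For `p < ∞`, `-H_p` is the generator of the consistent strongly
continuous semigroup on `ℓ^p`; moreover `H_∞ = (H_1)^*`. -/
def IsLpGenerator (G : MagneticSchrodingerGraph X)
    (S₂ : ℝ≥0 → G.ell 2 →L[ℂ] G.ell 2) (p : ℝ≥0∞) [Fact (1 ≤ p)]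
    (H : G.ell p →ₗ.[ℂ] G.ell p) : Prop :=
  (p ≠ ∞ ∧ G.IsLpGeneratorFinite S₂ p H) ∨
    (p = ∞ ∧ ∃ H₁ : G.ell 1 →ₗ.[ℂ] G.ell 1,
      G.IsLpGeneratorFinite S₂ 1 H₁ ∧ G.IsAdjointOfL1 p H₁ H)

end MagneticSchrodingerGraph

end

/-! Everything rests on one integrated identity. Let `S` be a strongly continuous semigroup on ℓ^p,
p < ∞, consistent with `S₂`, and let φ ∈ C_c(X) have 𝓗φ ∈ ℓ^q ∩ ℓ^2. Then ⟨S(t)f - f, φ⟩ = -⟨∫₀ᵗ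
S(s)f ds, 𝓗φ⟩ for every f ∈ ℓ^p (`IsConsistentSemigroup.pairing_apply_sub`). For f ∈ C_c(X) this is
symmetry of H_2 together with H_2φ = 𝓗φ, which is Green's formula (`form_eq_pairing`). Both sides
are continuous in f, so density of C_c(X) gives the rest, and no core of H_p has to be known.

Differentiating at t = 0 yields ⟨H_p f, φ⟩ = ⟨f, 𝓗φ⟩. Take φ = δ_x: away from x, m(y)|𝓗δ_x(y)| =
b(x,y), so Hölder's inequality puts f into F, and the right side becomes m(x)𝓗f(x). For p = ∞ the
same relation is read off from the definition of the adjoint, since C_c(X) ⊆ D(H_1) and H_1φ = 𝓗φ.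

For 1 < p < ∞, H_q is obtained from the adjoint semigroup. The integrated identity bounds ‖S'(t)φ -
φ‖_q by a multiple of t on C_c(X), which gives strong continuity. For p = 1 the adjoint of the
densely defined H_1 is used, and for p = ∞ the existence of H_1 is part of the hypothesis. Finally
C_c(X) ⊆ D(H_q): for q < ∞ the formula S₂(t)φ - φ = -∫₀ᵗ S₂(s)𝓗φ ds is carried from ℓ^2 to ℓ^q
pointwise; for q = ∞ the differentiated identity for H_1 is the adjoint relation. -/

noncomputable section

/-! ### Strongly continuous semigroups: calculus of orbits and symmetry -/

section Semigroup

open Set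

variable {E : Type*} [NormedAddCommGroup E] [NormedSpace ℂ E] {S : ℝ≥0 → E →L[ℂ] E}

/-- The orbit `s ↦ S s f`, extended to negative times by the constant `f`. -/
def semigroupOrbit (S : ℝ≥0 → E →L[ℂ] E) (f : E) (s : ℝ) : E := S s.toNNReal f

theorem mem_graph_semigroupGenerator {f g : E} :
    (f, g) ∈ (semigroupGenerator S).graph ↔
      Tendsto (semigroupQuotient S f) (𝓝[>] 0) (𝓝 g) := by
  rw [LinearPMap.mem_graph_iff]
  constructor
  · rintro ⟨y, rfl, rfl⟩
    exact y.2.choose_spec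
  · intro h
    have hf : ∃ g, Tendsto (semigroupQuotient S f) (𝓝[>] 0) (𝓝 g) := ⟨g, h⟩
    exact ⟨⟨f, hf⟩, rfl, tendsto_nhds_unique hf.choose_spec h⟩

namespace IsC0Semigroup

theorem exists_norm_le [CompleteSpace E] (hS : IsC0Semigroup S) (T : ℝ≥0) :
    ∃ M, ∀ t ≤ T, ‖S t‖ ≤ M := by
  have := banach_steinhaus (g := fun t : Icc 0 T => S t) (fun f => by
    obtain ⟨C, hC⟩ := (isCompact_Icc (a := 0) (b := T)).exists_bound_of_continuousOn
      (hS.continuous_orbit f).continuousOn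
    exact ⟨C, fun t => hC t t.2⟩)
  obtain ⟨M, hM⟩ := this
  exact ⟨M, fun t ht => hM ⟨t, zero_le, ht⟩⟩

/-- The local bound spreads continuity at 0 from the dense set to all vectors, and the semigroup law
then moves it to every time. -/
theorem of_dense (h0 : S 0 = ContinuousLinearMap.id ℂ E)
    (hadd : ∀ s t : ℝ≥0, S (s + t) = (S s).comp (S t))
    (hbd : ∀ T : ℝ≥0, ∃ M, ∀ t ≤ T, ‖S t‖ ≤ M) {D : Set E} (hD : Dense D)
    (hcont : ∀ f ∈ D, Tendsto (fun t => S t f) (𝓝 0) (𝓝 f)) : IsC0Semigroup S := by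
  have hzero : ∀ f, Tendsto (fun t => S t f - f) (𝓝 0) (𝓝 0) := by
    intro f
    obtain ⟨M, hM⟩ := hbd 1
    have hM0 : 0 ≤ M := (norm_nonneg _).trans (hM 0 zero_le)
    rw [NormedAddGroup.tendsto_nhds_zero]
    intro ε hε
    obtain ⟨g, hg, hfg⟩ := Metric.dense_iff.1 hD f (ε / (2 * (M + 1))) (by positivity)
    have h1 : ∀ᶠ t in 𝓝 (0 : ℝ≥0), t ≤ 1 := Iic_mem_nhds zero_lt_one
    have h2 : ∀ᶠ t in 𝓝 (0 : ℝ≥0), ‖S t g - g‖ < ε / 2 := by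
      have := (hcont g hfg).sub_const g
      rw [sub_self] at this
      exact NormedAddGroup.tendsto_nhds_zero.1 this _ (by positivity)
    filter_upwards [h1, h2] with t ht1 ht2
    have e : S t f - f = S t (f - g) - (f - g) + (S t g - g) := by
      rw [map_sub]; abel
    have hd : ‖f - g‖ < ε / (2 * (M + 1)) := by
      rw [← dist_eq_norm, dist_comm]; exact hg
    have h3 : ‖S t (f - g) - (f - g)‖ ≤ (M + 1) * ‖f - g‖ := by
      refine (norm_sub_le _ _).trans ?_
      have := (S t).le_of_opNorm_le (hM t ht1) (f - g)
      linarith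
    have h4 : (M + 1) * ‖f - g‖ < ε / 2 := by
      calc (M + 1) * ‖f - g‖ < (M + 1) * (ε / (2 * (M + 1))) := by gcongr
        _ = ε / 2 := by field_simp
    rw [e]
    linarith [norm_add_le (S t (f - g) - (f - g)) (S t g - g)]
  refine ⟨h0, hadd, fun f => continuous_iff_continuousAt.2 fun t₀ => ?_⟩
  obtain ⟨M, hM⟩ := hbd (t₀ + 1)
  have hM0 : 0 ≤ M := (norm_nonneg _).trans (hM 0 zero_le)
  rw [ContinuousAt, tendsto_iff_norm_sub_tendsto_zero]
  -- Subtraction is truncated, so one summand vanishes and the sum is |t - t₀|.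
  have hd : Tendsto (fun t : ℝ≥0 => (t - t₀) + (t₀ - t)) (𝓝 t₀) (𝓝 0) := by
    have : Continuous (fun t : ℝ≥0 => (t - t₀) + (t₀ - t)) := by fun_prop
    simpa using this.tendsto t₀
  have hlim : Tendsto (fun t => M * ‖S ((t - t₀) + (t₀ - t)) f - f‖) (𝓝 t₀) (𝓝 0) := by
    simpa using ((hzero f).comp hd).norm.const_mul M
  refine squeeze_zero' (Eventually.of_forall fun _ => norm_nonneg _) ?_ hlim
  have h1 : ∀ᶠ t in 𝓝 t₀, t ≤ t₀ + 1 := Iic_mem_nhds (lt_add_of_pos_right _ zero_lt_one)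
  filter_upwards [h1] with t ht
  rcases le_total t₀ t with h | h
  · rw [tsub_eq_zero_of_le h, add_zero]
    have e : S t f - S t₀ f = S t₀ (S (t - t₀) f - f) := by
      rw [map_sub, ← ContinuousLinearMap.comp_apply, ← hadd, add_tsub_cancel_of_le h]
    rw [e]
    exact (S t₀).le_of_opNorm_le (hM _ le_self_add) _
  · rw [tsub_eq_zero_of_le h, zero_add]
    have e : S t f - S t₀ f = - S t (S (t₀ - t) f - f) := by
      rw [map_sub, ← ContinuousLinearMap.comp_apply, ← hadd, add_tsub_cancel_of_le h, neg_sub]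
    rw [e, norm_neg]
    exact (S t).le_of_opNorm_le (hM _ ht) _

theorem continuous_semigroupOrbit (hS : IsC0Semigroup S) (f : E) :
    Continuous (semigroupOrbit S f) :=
  (hS.continuous_orbit f).comp continuous_real_toNNReal

theorem semigroupOrbit_zero (hS : IsC0Semigroup S) (f : E) : semigroupOrbit S f 0 = f := by
  simp [semigroupOrbit, hS.map_zero]

theorem semigroupOrbit_add (hS : IsC0Semigroup S) (f : E) {s t : ℝ} (hs : 0 ≤ s) (ht : 0 ≤ t) :
    semigroupOrbit S f (s + t) = S s.toNNReal (semigroupOrbit S f t) := by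
  simp [semigroupOrbit, Real.toNNReal_add hs ht, hS.map_add]

theorem apply_comm (hS : IsC0Semigroup S) (s t : ℝ≥0) (f : E) : S s (S t f) = S t (S s f) := by
  rw [← ContinuousLinearMap.comp_apply, ← hS.map_add, add_comm, hS.map_add,
    ContinuousLinearMap.comp_apply]

/-- This makes the generator a right derivative in a real variable, so that one-variable calculus
applies to orbits. -/
theorem tendsto_quotient_iff (hS : IsC0Semigroup S) {f g : E} :
    Tendsto (semigroupQuotient S f) (𝓝[>] 0) (𝓝 g) ↔
      HasDerivWithinAt (semigroupOrbit S f) g (Ici 0) 0 := by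
  rw [← hasDerivWithinAt_Ioi_iff_Ici, hasDerivWithinAt_iff_tendsto_slope' (by simp)]
  have key : ∀ t : ℝ≥0, slope (semigroupOrbit S f) 0 t = semigroupQuotient S f t := by
    intro t
    rw [slope_def_module, hS.semigroupOrbit_zero, semigroupQuotient, semigroupOrbit,
      Real.toNNReal_coe, sub_zero, ← Complex.ofReal_inv, Complex.coe_smul]
  constructor
  · intro h
    have h1 : Tendsto Real.toNNReal (𝓝[>] 0) (𝓝[>] 0) := by
      refine tendsto_nhdsWithin_iff.2 ⟨?_, ?_⟩
      · have := (continuous_real_toNNReal.tendsto 0).mono_left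
          (nhdsWithin_le_nhds (s := Ioi (0 : ℝ)))
        simpa using this
      · filter_upwards [self_mem_nhdsWithin] with x hx
        simpa using hx
    refine (h.comp h1).congr' ?_
    filter_upwards [self_mem_nhdsWithin] with x hx
    rw [Function.comp_apply, ← key, Real.coe_toNNReal _ (le_of_lt hx)]
  · intro h
    have h1 : Tendsto ((↑) : ℝ≥0 → ℝ) (𝓝[>] 0) (𝓝[>] 0) := by
      refine tendsto_nhdsWithin_iff.2 ⟨?_, ?_⟩
      · have := (NNReal.continuous_coe.tendsto 0).mono_left
          (nhdsWithin_le_nhds (s := Ioi (0 : ℝ≥0)))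
        simpa using this
      · filter_upwards [self_mem_nhdsWithin] with x hx
        simpa using hx
    exact (h.comp h1).congr fun t => key t

theorem tendsto_quotient_apply (hS : IsC0Semigroup S) {f g : E}
    (h : Tendsto (semigroupQuotient S f) (𝓝[>] 0) (𝓝 g)) (s : ℝ≥0) :
    Tendsto (semigroupQuotient S (S s f)) (𝓝[>] 0) (𝓝 (S s g)) := by
  refine (((S s).continuous.tendsto g).comp h).congr fun t => ?_
  rw [Function.comp_apply, semigroupQuotient, semigroupQuotient, map_smul, map_sub,
    hS.apply_comm]

theorem hasDerivWithinAt_orbit (hS : IsC0Semigroup S) {f g : E}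
    (h : Tendsto (semigroupQuotient S f) (𝓝[>] 0) (𝓝 g)) {s : ℝ} (hs : 0 ≤ s) :
    HasDerivWithinAt (semigroupOrbit S f) (semigroupOrbit S g s) (Ici s) s := by
  have h1 := hS.tendsto_quotient_iff.1 (hS.tendsto_quotient_apply h s.toNNReal)
  have h2 : HasDerivWithinAt (fun x : ℝ => x - s) 1 (Ici s) s :=
    (hasDerivWithinAt_id s _).sub_const s
  have h3 := HasDerivWithinAt.scomp_of_eq (t' := Ici 0) s h1 h2
    (fun x hx => by simpa using hx) (sub_self s).symm
  rw [one_smul] at h3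
  refine h3.congr (fun x hx => ?_) ?_
  · have : x = s + (x - s) := by ring
    conv_lhs => rw [this, hS.semigroupOrbit_add f hs (sub_nonneg.2 hx)]
    simp only [Function.comp_apply, semigroupOrbit]
    exact hS.apply_comm _ _ _
  · simp [semigroupOrbit, hS.map_zero]

theorem hasDerivAt_integral_orbit [CompleteSpace E] (hS : IsC0Semigroup S) (f : E) (s : ℝ) :
    HasDerivAt (fun u => ∫ x in (0 : ℝ)..u, semigroupOrbit S f x) (semigroupOrbit S f s) s :=
  intervalIntegral.integral_hasDerivAt_right
    ((hS.continuous_semigroupOrbit f).intervalIntegrable _ _)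
    (hS.continuous_semigroupOrbit f).aestronglyMeasurable.stronglyMeasurableAtFilter
    (hS.continuous_semigroupOrbit f).continuousAt

/-- The two sides have the same right derivative, and a continuous function with vanishing right
derivative is constant. -/
theorem orbit_sub_eq_integral [CompleteSpace E] (hS : IsC0Semigroup S) {f g : E}
    (h : Tendsto (semigroupQuotient S f) (𝓝[>] 0) (𝓝 g)) {t : ℝ} (ht : 0 ≤ t) :
    semigroupOrbit S f t - f = ∫ s in (0 : ℝ)..t, semigroupOrbit S g s := by
  have hI := hS.hasDerivAt_integral_orbit g
  have hc : ContinuousOn (fun t => semigroupOrbit S f t - ∫ s in (0 : ℝ)..t, semigroupOrbit S g s)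
      (Icc 0 t) :=
    ((hS.continuous_semigroupOrbit f).sub
      (continuous_iff_continuousAt.2 fun s => (hI s).continuousAt)).continuousOn
  have := constant_of_has_deriv_right_zero hc (fun x hx => by
    have := (hS.hasDerivWithinAt_orbit h hx.1).sub (hI x).hasDerivWithinAt
    rwa [sub_self] at this) t ⟨ht, le_rfl⟩
  simp only [intervalIntegral.integral_same, sub_zero, hS.semigroupOrbit_zero] at this
  rw [sub_eq_iff_eq_add, ← sub_eq_iff_eq_add']
  exact this

theorem tendsto_quotient_of_integral [CompleteSpace E] (hS : IsC0Semigroup S) {f g : E}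
    (h : ∀ t : ℝ, 0 ≤ t → semigroupOrbit S f t - f = ∫ s in (0 : ℝ)..t, semigroupOrbit S g s) :
    Tendsto (semigroupQuotient S f) (𝓝[>] 0) (𝓝 g) := by
  rw [hS.tendsto_quotient_iff]
  have := ((hS.hasDerivAt_integral_orbit g 0).const_add f).hasDerivWithinAt (s := Ici 0)
  rw [hS.semigroupOrbit_zero] at this
  refine this.congr (fun x hx => ?_) ?_
  · rw [← h x hx]; abel
  · rw [← h 0 le_rfl]; abel

/-- The integral formula upgrades the right derivative to a two-sided one, which `inner_apply_left`
needs because it runs one orbit backwards. -/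
theorem hasDerivAt_orbit [CompleteSpace E] (hS : IsC0Semigroup S) {f g : E}
    (h : Tendsto (semigroupQuotient S f) (𝓝[>] 0) (𝓝 g)) {s : ℝ} (hs : 0 < s) :
    HasDerivAt (semigroupOrbit S f) (semigroupOrbit S g s) s := by
  refine ((hS.hasDerivAt_integral_orbit g s).const_add f).congr_of_eventuallyEq ?_
  filter_upwards [Ioi_mem_nhds hs] with x hx
  rw [← hS.orbit_sub_eq_integral h (le_of_lt hx)]; abel

/-- With F(r) = ∫₀ʳ S(s)f ds, applying S(h) shifts the window of integration: S(h)F(r) = F(r+h) -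
F(h). -/
theorem tendsto_quotient_integral [CompleteSpace E] (hS : IsC0Semigroup S) (f : E) {r : ℝ}
    (hr : 0 ≤ r) :
    Tendsto (semigroupQuotient S (∫ s in (0 : ℝ)..r, semigroupOrbit S f s)) (𝓝[>] 0)
      (𝓝 (semigroupOrbit S f r - f)) := by
  have hint : ∀ a b, IntervalIntegrable (semigroupOrbit S f) volume a b := fun a b =>
    (hS.continuous_semigroupOrbit f).intervalIntegrable a b
  set F : ℝ → E := fun r => ∫ s in (0 : ℝ)..r, semigroupOrbit S f s with hF
  change Tendsto (semigroupQuotient S (F r)) _ _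
  rw [hS.tendsto_quotient_iff]
  have h1 : HasDerivAt (fun h => F (r + h) - F h) (semigroupOrbit S f r - f) 0 := by
    have h2 := hS.hasDerivAt_integral_orbit f (r + 0)
    have h3 := hS.hasDerivAt_integral_orbit f 0
    rw [hS.semigroupOrbit_zero] at h3
    rw [add_zero] at h2
    refine HasDerivAt.sub ?_ h3
    exact HasDerivAt.comp_const_add r 0 (by rwa [add_zero])
  refine h1.hasDerivWithinAt.congr (fun h hh => ?_) ?_
  · have h4 : semigroupOrbit S (F r) h = ∫ s in (0 : ℝ)..r, semigroupOrbit S f (s + h) := by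
      rw [semigroupOrbit, hF]
      simp only
      rw [← ContinuousLinearMap.intervalIntegral_comp_comm _ (hint _ _)]
      refine intervalIntegral.integral_congr fun s hs => ?_
      rw [uIcc_of_le hr] at hs
      change S h.toNNReal (semigroupOrbit S f s) = semigroupOrbit S f (s + h)
      rw [add_comm, hS.semigroupOrbit_add f hh hs.1]
    rw [h4, intervalIntegral.integral_comp_add_right, zero_add, hF]
    simp only
    rw [intervalIntegral.integral_interval_sub_left (hint _ _) (hint _ _)]
  · simp [hF, hS.semigroupOrbit_zero]

/-- The averages (1/t)∫₀ᵗ S(s)f ds lie in the domain and tend to f. -/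
theorem dense_domain [CompleteSpace E] (hS : IsC0Semigroup S) :
    Dense ((semigroupGenerator S).domain : Set E) := by
  intro f
  have hlim : Tendsto (fun t : ℝ => t⁻¹ • ∫ s in (0 : ℝ)..t, semigroupOrbit S f s) (𝓝[>] 0)
      (𝓝 f) := by
    have h3 := (hS.hasDerivAt_integral_orbit f 0).hasDerivWithinAt (s := Ioi 0)
    rw [hS.semigroupOrbit_zero, hasDerivWithinAt_iff_tendsto_slope' (by simp)] at h3
    refine h3.congr fun t => ?_
    simp [slope_def_module]
  refine mem_closure_of_tendsto hlim ?_
  filter_upwards [self_mem_nhdsWithin] with t ht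
  rw [← Complex.coe_smul]
  exact Submodule.smul_mem _ _ ⟨_, hS.tendsto_quotient_integral f (le_of_lt ht)⟩

theorem norm_integral_orbit_le {M : ℝ} {T t : ℝ≥0} (hM : ∀ t ≤ T, ‖S t‖ ≤ M) (ht : t ≤ T)
    (f : E) : ‖∫ s in (0 : ℝ)..t, semigroupOrbit S f s‖ ≤ M * ‖f‖ * t := by
  have := intervalIntegral.norm_integral_le_of_norm_le_const (a := 0) (b := (t : ℝ))
    (f := semigroupOrbit S f) (C := M * ‖f‖) (fun s hs => by
      rw [uIoc_of_le t.coe_nonneg] at hs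
      refine (S s.toNNReal).le_of_opNorm_le (hM _ ?_) f
      exact (Real.toNNReal_le_iff_le_coe.2 hs.2).trans ht)
  rwa [sub_zero, abs_of_nonneg t.coe_nonneg] at this

theorem continuous_integral_orbit [CompleteSpace E] (hS : IsC0Semigroup S) (t : ℝ≥0) :
    Continuous fun f => ∫ s in (0 : ℝ)..t, semigroupOrbit S f s := by
  obtain ⟨M, hM⟩ := hS.exists_norm_le t
  have hM0 : 0 ≤ M := (norm_nonneg _).trans (hM 0 zero_le)
  refine (LipschitzWith.of_dist_le_mul (K := ⟨M * t, mul_nonneg hM0 t.2⟩) fun f g => ?_).continuous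
  rw [dist_eq_norm, dist_eq_norm, ← intervalIntegral.integral_sub
    ((hS.continuous_semigroupOrbit f).intervalIntegrable _ _)
    ((hS.continuous_semigroupOrbit g).intervalIntegrable _ _)]
  simp only [semigroupOrbit, ← map_sub]
  refine (norm_integral_orbit_le hM le_rfl (f - g)).trans_eq ?_
  change M * ‖f - g‖ * t = M * t * ‖f - g‖
  ring

end IsC0Semigroup

/-- On the domain, s ↦ ⟨S(t-s)f, S(s)g⟩ has derivative zero by symmetry of the generator, so its
values at 0 and t agree. Density in each argument finishes. -/
theorem IsC0Semigroup.inner_apply_left {E : Type*} [NormedAddCommGroup E] [InnerProductSpace ℂ E]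
    [CompleteSpace E] {S : ℝ≥0 → E →L[ℂ] E} (hS : IsC0Semigroup S)
    (hsymm : ∀ f f' g g' : E, (f, f') ∈ (semigroupGenerator S).graph →
      (g, g') ∈ (semigroupGenerator S).graph → inner ℂ f' g = inner ℂ f g')
    (t : ℝ≥0) (f g : E) : inner ℂ (S t f) g = inner ℂ f (S t g) := by
  have hdom : ∀ f f' g g' : E, Tendsto (semigroupQuotient S f) (𝓝[>] 0) (𝓝 f') →
      Tendsto (semigroupQuotient S g) (𝓝[>] 0) (𝓝 g') →
      inner ℂ (S t f) g = inner ℂ f (S t g) := by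
    intro f f' g g' hf hg
    have hc : ContinuousOn
        (fun s : ℝ => (inner ℂ (semigroupOrbit S f (t - s)) (semigroupOrbit S g s) : ℂ))
        (Icc 0 t) := by
      refine Continuous.continuousOn ?_
      exact ((hS.continuous_semigroupOrbit f).comp (by fun_prop)).inner
        (hS.continuous_semigroupOrbit g)
    have := constant_of_has_deriv_right_zero hc (fun s hs => by
      have h1 : HasDerivWithinAt (fun s : ℝ => semigroupOrbit S f (t - s))
          (-semigroupOrbit S f' (t - s)) (Ici s) s := by
        have := (hS.hasDerivAt_orbit hf (sub_pos.2 hs.2)).scomp s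
          ((hasDerivAt_id s).const_sub (t : ℝ))
        rw [neg_one_smul] at this
        exact this.hasDerivWithinAt
      have h2 := hS.hasDerivWithinAt_orbit hg hs.1
      have h3 := h1.inner ℂ h2
      have h4 : inner ℂ (semigroupOrbit S f' (t - s)) (semigroupOrbit S g s) =
          inner ℂ (semigroupOrbit S f (t - s)) (semigroupOrbit S g' s) := hsymm _ _ _ _
        (mem_graph_semigroupGenerator.2 (hS.tendsto_quotient_apply hf (t - s : ℝ).toNNReal))
        (mem_graph_semigroupGenerator.2 (hS.tendsto_quotient_apply hg s.toNNReal))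
      rw [inner_neg_left, add_neg_eq_zero.2 h4.symm] at h3
      exact h3) t ⟨t.2, le_rfl⟩
    simp only [sub_self, sub_zero, hS.semigroupOrbit_zero] at this
    simpa [semigroupOrbit] using this.symm
  have hD := hS.dense_domain
  have hcl : ∀ f : E, ∀ g ∈ (semigroupGenerator S).domain,
      inner ℂ (S t f) g = inner ℂ f (S t g) := by
    rintro f g ⟨g', hg⟩
    refine hD.induction (P := fun f => inner ℂ (S t f) g = inner ℂ f (S t g)) ?_
      (isClosed_eq (by fun_prop) (by fun_prop)) f
    rintro f ⟨f', hf⟩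
    exact hdom f f' g g' hf hg
  exact hD.induction (P := fun g => inner ℂ (S t f) g = inner ℂ f (S t g)) (hcl f)
    (isClosed_eq (by fun_prop) (by fun_prop)) g

end Semigroup

/-! ### The spaces ℓ^p(X, m) and their pairing -/

namespace MagneticSchrodingerGraph

section Functions

variable {X : Type*} {G : MagneticSchrodingerGraph X}

theorem pairing_conj (f g : X → ℂ) : conj (G.pairing f g) = G.pairing g f := by
  rw [pairing, pairing, Complex.conj_tsum]
  refine tsum_congr fun x => ?_
  simp only [map_mul, Complex.conj_ofReal, Complex.conj_conj]
  ring

theorem pairing_finsupp_left (φ : X →₀ ℂ) (g : X → ℂ) :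
    G.pairing φ g = φ.sum fun x z => z * ((G.m x : ℂ) * conj (g x)) := by
  rw [pairing, tsum_eq_sum (s := φ.support) (fun x hx => by simp_all), Finsupp.sum]
  refine Finset.sum_congr rfl fun x _ => by ring

theorem pairing_single_left (x : X) (z : ℂ) (g : X → ℂ) :
    G.pairing (Finsupp.single x z : X →₀ ℂ) g = z * ((G.m x : ℂ) * conj (g x)) := by
  rw [pairing_finsupp_left, Finsupp.sum_single_index (by simp)]

theorem pairing_single_right (f : X → ℂ) (x : X) :
    G.pairing f (Finsupp.single x 1 : X →₀ ℂ) = (G.m x : ℂ) * f x := by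
  rw [← pairing_conj, pairing_single_left]
  simp

theorem m_ne_zero (x : X) : (G.m x : ℂ) ≠ 0 := by
  exact_mod_cast (G.m_pos x).ne'

theorem eq_of_pairing_left {g g' : X → ℂ}
    (h : ∀ φ : X →₀ ℂ, G.pairing φ g = G.pairing φ g') : g = g' := by
  funext x
  have := h (Finsupp.single x 1)
  rw [pairing_single_left, pairing_single_left, one_mul, one_mul,
    mul_right_inj' (m_ne_zero x)] at this
  exact (starRingEnd ℂ).injective this

end Functions

theorem integrable_mul_conj {X : Type*} [MeasurableSpace X] {G : MagneticSchrodingerGraph X}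
    {p q : ℝ≥0∞} [p.HolderConjugate q] (f : G.ell p) (g : G.ell q) :
    Integrable (fun x => f x * conj (g x)) G.measure := by
  have h : MemLp (fun x => conj (g x)) q G.measure := (Lp.memLp g).star
  exact memLp_one_iff_integrable.1 (h.mul (Lp.memLp f))

variable {X : Type*} [MeasurableSpace X] [DiscreteMeasurableSpace X]
  {G : MagneticSchrodingerGraph X} {p q : ℝ≥0∞}

theorem measure_singleton (G : MagneticSchrodingerGraph X) (a : X) :
    G.measure {a} = ENNReal.ofReal (G.m a) := by
  classical
  rw [measure, Measure.sum_apply _ (MeasurableSet.of_discrete),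
    tsum_eq_single a (fun x hx => by simp [hx])]
  simp

/-- Every point has positive mass, so the only null set is empty and elements of ℓ^p can be handled
as functions. -/
theorem ae_measure_iff {P : X → Prop} : (∀ᵐ x ∂G.measure, P x) ↔ ∀ x, P x := by
  refine ⟨fun h x => ?_, fun h => Eventually.of_forall h⟩
  by_contra hx
  have h1 : G.measure {x} ≤ 0 := by
    rw [← ae_iff.1 h]
    exact measure_mono (by simpa using hx)
  rw [measure_singleton] at h1
  simpa using (G.m_pos x).trans_le (ENNReal.ofReal_eq_zero.1 (le_antisymm h1 zero_le))

theorem coe_toLp {f : X → ℂ} (hf : MemLp f p G.measure) : ⇑(hf.toLp f) = f :=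
  funext (ae_measure_iff.1 hf.coeFn_toLp)

@[simp]
theorem coe_ccToLp (φ : X →₀ ℂ) : ⇑(G.ccToLp p φ) = φ := coe_toLp _

theorem ell_ext {f g : G.ell p} (h : ∀ x, (f : X → ℂ) x = (g : X → ℂ) x) : f = g :=
  Lp.ext (ae_measure_iff.2 h)

theorem ell_coe_add (f g : G.ell p) (x : X) :
    ((f + g : G.ell p) : X → ℂ) x = (f : X → ℂ) x + (g : X → ℂ) x :=
  ae_measure_iff.1 (Lp.coeFn_add f g) x

theorem ell_coe_sub (f g : G.ell p) (x : X) :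
    ((f - g : G.ell p) : X → ℂ) x = (f : X → ℂ) x - (g : X → ℂ) x :=
  ae_measure_iff.1 (Lp.coeFn_sub f g) x

theorem ell_coe_neg (f : G.ell p) (x : X) :
    ((-f : G.ell p) : X → ℂ) x = -(f : X → ℂ) x :=
  ae_measure_iff.1 (Lp.coeFn_neg f) x

theorem ell_coe_smul (a : ℂ) (f : G.ell p) (x : X) :
    ((a • f : G.ell p) : X → ℂ) x = a * (f : X → ℂ) x :=
  ae_measure_iff.1 (Lp.coeFn_smul a f) x

theorem ell_coe_star (f : G.ell p) (x : X) :
    ((star f : G.ell p) : X → ℂ) x = conj ((f : X → ℂ) x) :=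
  ae_measure_iff.1 (Lp.coeFn_star f) x

/-- The inclusion of `C_c(X)` into `ℓ^p(X, m)` as a linear map. -/
def ccToLpLin (G : MagneticSchrodingerGraph X) (p : ℝ≥0∞) : (X →₀ ℂ) →ₗ[ℂ] G.ell p where
  toFun := G.ccToLp p
  map_add' φ ψ := ell_ext fun x => by rw [ell_coe_add]; simp
  map_smul' a φ := ell_ext fun x => by rw [RingHom.id_apply, ell_coe_smul]; simp

theorem ccToLp_sub (φ ψ : X →₀ ℂ) : G.ccToLp p (φ - ψ) = G.ccToLp p φ - G.ccToLp p ψ :=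
  (G.ccToLpLin p).map_sub φ ψ

theorem lintegral_measure (f : X → ℝ≥0∞) :
    ∫⁻ x, f x ∂G.measure = ∑' x, ENNReal.ofReal (G.m x) * f x := by
  rw [measure, lintegral_sum_measure]
  simp

theorem hasSum_integral {f : X → ℂ} (hf : Integrable f G.measure) :
    HasSum (fun x => (G.m x : ℂ) * f x) (∫ x, f x ∂G.measure) := by
  have := hasSum_integral_measure hf
  simp only [integral_smul_measure, integral_dirac, ENNReal.toReal_ofReal (G.m_pos _).le,
    Complex.real_smul] at this
  exact this

theorem summable_norm_of_integrable {f : X → ℂ} (hf : Integrable f G.measure) :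
    Summable fun x => G.m x * ‖f x‖ := by
  have := (hasSum_integral_measure hf.norm).summable
  simp only [integral_smul_measure, integral_dirac, ENNReal.toReal_ofReal (G.m_pos _).le,
    smul_eq_mul] at this
  exact this

theorem eLpNorm_measure (f : X → ℂ) (hp0 : p ≠ 0) (hp : p ≠ ∞) :
    eLpNorm f p G.measure =
      (∑' x, ENNReal.ofReal (G.m x) * ‖f x‖ₑ ^ p.toReal) ^ (1 / p.toReal) := by
  rw [eLpNorm_eq_lintegral_rpow_enorm_toReal hp0 hp, lintegral_measure]

section Pairing

variable [Fact (1 ≤ p)] [Fact (1 ≤ q)] [hpq : p.HolderConjugate q]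

/-- The functional `f ↦ ⟨f, g⟩` on `ℓ^p(X, m)` given by `g ∈ ℓ^q(X, m)`. -/
def pairingL (p : ℝ≥0∞) {q : ℝ≥0∞} [Fact (1 ≤ p)] [Fact (1 ≤ q)] [hpq : p.HolderConjugate q]
    (g : G.ell q) : G.ell p →L[ℂ] ℂ :=
  (ContinuousLinearMap.lpPairing G.measure p q (ContinuousLinearMap.mul ℂ ℂ)).flip (star g)

theorem pairingL_apply (f : G.ell p) (g : G.ell q) : pairingL p g f = G.pairing f g := by
  rw [pairingL, ContinuousLinearMap.flip_apply, ContinuousLinearMap.lpPairing_eq_integral,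
    pairing]
  simp only [ContinuousLinearMap.mul_apply', ell_coe_star]
  rw [← (hasSum_integral (integrable_mul_conj f g)).tsum_eq]
  simp only [mul_assoc]

theorem exists_norm_pairing_le (G : MagneticSchrodingerGraph X) (p q : ℝ≥0∞) [Fact (1 ≤ p)]
    [Fact (1 ≤ q)] [hpq : p.HolderConjugate q] :
    ∃ C, 0 ≤ C ∧ ∀ (f : G.ell p) (g : G.ell q), ‖G.pairing f g‖ ≤ C * ‖f‖ * ‖g‖ := by
  refine ⟨‖ContinuousLinearMap.lpPairing G.measure p q (ContinuousLinearMap.mul ℂ ℂ)‖,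
    ContinuousLinearMap.opNorm_nonneg _, fun f g => ?_⟩
  rw [← pairingL_apply, pairingL, ContinuousLinearMap.flip_apply]
  refine (ContinuousLinearMap.le_opNorm₂ _ _ _).trans_eq ?_
  congr 1
  simp only [Lp.norm_def]
  rw [eLpNorm_congr_ae (Lp.coeFn_star g), eLpNorm_star]

theorem pairing_add_left (f f' : G.ell p) (g : G.ell q) :
    G.pairing (f + f' : G.ell p) g = G.pairing f g + G.pairing f' g := by
  simp only [← pairingL_apply, map_add]

theorem pairing_sub_left (f f' : G.ell p) (g : G.ell q) :
    G.pairing (f - f' : G.ell p) g = G.pairing f g - G.pairing f' g := by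
  simp only [← pairingL_apply, map_sub]

theorem pairing_smul_left (a : ℂ) (f : G.ell p) (g : G.ell q) :
    G.pairing (a • f : G.ell p) g = a * G.pairing f g := by
  simp only [← pairingL_apply, map_smul, smul_eq_mul]

theorem pairing_add_right (f : G.ell p) (g g' : G.ell q) :
    G.pairing f (g + g' : G.ell q) = G.pairing f g + G.pairing f g' := by
  have := hpq.symm
  rw [← pairing_conj, pairing_add_left (p := q) (q := p), map_add, pairing_conj, pairing_conj]

theorem pairing_sub_right (f : G.ell p) (g g' : G.ell q) :
    G.pairing f (g - g' : G.ell q) = G.pairing f g - G.pairing f g' := by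
  have := hpq.symm
  rw [← pairing_conj, pairing_sub_left (p := q) (q := p), map_sub, pairing_conj, pairing_conj]

theorem pairing_smul_right (a : ℂ) (f : G.ell p) (g : G.ell q) :
    G.pairing f (a • g : G.ell q) = conj a * G.pairing f g := by
  have := hpq.symm
  rw [← pairing_conj, pairing_smul_left (p := q) (q := p), map_mul, pairing_conj]

end Pairing

/-- Evaluation at `x` as a continuous functional on `ℓ^p(X, m)`. -/
theorem exists_eval (G : MagneticSchrodingerGraph X) (p : ℝ≥0∞) [Fact (1 ≤ p)] (x : X) :
    ∃ L : G.ell p →L[ℂ] ℂ, ∀ f : G.ell p, L f = f x := by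
  have : Fact (1 ≤ p.conjExponent) := ⟨le_self_add⟩
  have : p.HolderConjugate p.conjExponent := ENNReal.HolderConjugate.conjExponent Fact.out
  refine ⟨(G.m x : ℂ)⁻¹ • pairingL p (G.ccToLp p.conjExponent (Finsupp.single x 1)), fun f => ?_⟩
  rw [smul_apply, pairingL_apply, coe_ccToLp, pairing_single_right,
    smul_eq_mul, inv_mul_cancel_left₀ (m_ne_zero x)]

theorem inner_eq_pairing (f g : G.ell 2) : inner ℂ g f = G.pairing f g := by
  have : ENNReal.HolderConjugate 2 2 := inferInstance
  rw [L2.inner_def, pairing]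
  simp only [RCLike.inner_apply]
  rw [← (hasSum_integral (integrable_mul_conj f g)).tsum_eq]
  simp only [mul_assoc]

/-- Truncations to finite sets converge: the p-th power of the error is the tail of a convergent
series. -/
theorem dense_range_ccToLp [Fact (1 ≤ p)] (hp : p ≠ ∞) : Dense (Set.range (G.ccToLp p)) := by
  classical
  intro f
  have hp0 : p ≠ 0 := (zero_lt_one.trans_le (Fact.out : 1 ≤ p)).ne'
  have hp1 : 0 < p.toReal := ENNReal.toReal_pos hp0 hp
  have hfin : ∑' x, ENNReal.ofReal (G.m x) * ‖f x‖ₑ ^ p.toReal ≠ ∞ := by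
    have := Lp.eLpNorm_ne_top f
    rw [eLpNorm_measure _ hp0 hp] at this
    exact fun h => this (by rw [h, ENNReal.top_rpow_of_pos (by positivity)])
  have hlim : Tendsto (fun A : Finset X => G.ccToLp p (Finsupp.indicator A fun x _ => f x))
      atTop (𝓝 f) := by
    rw [Lp.tendsto_Lp_iff_tendsto_eLpNorm']
    have h1 := (ENNReal.tendsto_tsum_compl_atTop_zero hfin).ennrpow_const (1 / p.toReal)
    rw [ENNReal.zero_rpow_of_pos (by positivity)] at h1
    refine h1.congr fun A => ?_
    rw [eLpNorm_measure _ hp0 hp, coe_ccToLp]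
    congr 1
    have := tsum_subtype {x | x ∉ A} (fun x => ENNReal.ofReal (G.m x) * ‖f x‖ₑ ^ p.toReal)
    refine this.trans (tsum_congr fun x => ?_)
    by_cases hx : x ∈ A
    · simp [hx, Finsupp.indicator_apply, hp1]
    · simp [hx, Finsupp.indicator_apply]
  exact mem_closure_of_tendsto hlim (Eventually.of_forall fun A => ⟨_, rfl⟩)

end MagneticSchrodingerGraph

/-! ### Duality of ℓ^p and ℓ^q tested on C_c(X) -/

namespace MagneticSchrodingerGraph

variable {X : Type*} [MeasurableSpace X] [DiscreteMeasurableSpace X]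
  {G : MagneticSchrodingerGraph X} {p q : ℝ≥0∞}

theorem norm_ccToLp [Fact (1 ≤ p)] (hp : p ≠ ∞) (φ : X →₀ ℂ) {A : Finset X}
    (hA : ∀ x ∉ A, φ x = 0) :
    ‖G.ccToLp p φ‖ = (∑ x ∈ A, G.m x * ‖φ x‖ ^ p.toReal) ^ (1 / p.toReal) := by
  have hp0 : p ≠ 0 := (zero_lt_one.trans_le (Fact.out : 1 ≤ p)).ne'
  have hp1 : 0 < p.toReal := ENNReal.toReal_pos hp0 hp
  rw [Lp.norm_def, eLpNorm_measure _ hp0 hp, coe_ccToLp, ← ENNReal.toReal_rpow,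
    tsum_eq_sum (s := A) (fun x hx => by simp [hA x hx, hp1]), ENNReal.toReal_sum]
  · congr 1
    refine Finset.sum_congr rfl fun x _ => ?_
    rw [ENNReal.toReal_mul, ENNReal.toReal_ofReal (G.m_pos x).le, ← ENNReal.toReal_rpow,
      toReal_enorm]
  · intro x _
    exact ENNReal.mul_ne_top ENNReal.ofReal_ne_top
      (ENNReal.rpow_ne_top_of_nonneg hp1.le enorm_ne_top)

/-- Converse of Hölder's inequality. The extremal test function φ = |h|^(q-2) h on `A` has ⟨φ, h⟩ =
N and ‖φ‖_p = N^(1/p), whence N^(1/q) ≤ C. -/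
theorem sum_rpow_le_of_pairing_le [Fact (1 ≤ p)] (hp : p ≠ ∞)
    (hpq : p.toReal.HolderConjugate q.toReal) {h : X → ℂ} {C : ℝ} (hC : 0 ≤ C)
    (H : ∀ φ : X →₀ ℂ, ‖G.pairing φ h‖ ≤ C * ‖G.ccToLp p φ‖) (A : Finset X) :
    ∑ x ∈ A, G.m x * ‖h x‖ ^ q.toReal ≤ C ^ q.toReal := by
  classical
  set r := q.toReal with hr
  have hr1 : 1 < r := hpq.symm.lt
  set N := ∑ x ∈ A, G.m x * ‖h x‖ ^ r with hN
  have hN0 : 0 ≤ N := Finset.sum_nonneg fun x _ =>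
    mul_nonneg (G.m_pos x).le (by positivity)
  set φ : X →₀ ℂ := Finsupp.indicator A fun x _ => ((‖h x‖ ^ (r - 2) : ℝ) : ℂ) * h x with hφ
  have hφA : ∀ x ∈ A, φ x = ((‖h x‖ ^ (r - 2) : ℝ) : ℂ) * h x := fun x hx => by
    rw [hφ, Finsupp.indicator_of_mem hx]
  have hφA' : ∀ x ∉ A, φ x = 0 := fun x hx => by
    rw [hφ, Finsupp.indicator_of_notMem hx]
  have h1 : G.pairing φ h = (N : ℂ) := by
    rw [pairing, tsum_eq_sum (s := A) (fun x hx => by simp [hφA' x hx]), hN, Complex.ofReal_sum]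
    refine Finset.sum_congr rfl fun x hx => ?_
    rw [hφA x hx, mul_assoc, mul_assoc, Complex.mul_conj, Complex.normSq_eq_norm_sq,
      ← Complex.ofReal_mul, ← Complex.ofReal_mul]
    congr 2
    -- The exponent r - 2 may be negative, so zeros of h are treated apart.
    rcases eq_or_ne (h x) 0 with h0 | h0
    · rw [h0, norm_zero, Real.zero_rpow (by linarith : r ≠ 0)]; simp
    · rw [← Real.rpow_natCast, ← Real.rpow_add (norm_pos_iff.2 h0)]
      congr 1; push_cast; ring
  have h2 : ‖G.ccToLp p φ‖ = N ^ (1 / p.toReal) := by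
    rw [norm_ccToLp hp φ hφA', hN]
    congr 1
    refine Finset.sum_congr rfl fun x hx => ?_
    rw [hφA x hx, norm_mul, Complex.norm_real, Real.norm_of_nonneg (by positivity)]
    congr 1
    rcases eq_or_ne (h x) 0 with h0 | h0
    · rw [h0, norm_zero, mul_zero, Real.zero_rpow (by linarith : r ≠ 0),
        Real.zero_rpow hpq.ne_zero]
    · have hpos := norm_pos_iff.2 h0
      nth_rewrite 2 [← Real.rpow_one ‖h x‖]
      rw [← Real.rpow_add hpos, ← Real.rpow_mul hpos.le]
      congr 1
      have := hpq.symm.sub_one_mul_conj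
      linarith
  have h3 := H φ
  rw [h1, h2, Complex.norm_real, Real.norm_of_nonneg hN0] at h3
  rcases hN0.eq_or_lt with h0 | h0
  · rw [← h0]; positivity
  · have h4 : N ^ (1 / r) ≤ C := by
      have h5 : N = N ^ (1 / r) * N ^ (1 / p.toReal) := by
        rw [← Real.rpow_add h0]
        have := hpq.symm.inv_add_inv_eq_one
        rw [one_div, one_div, this, Real.rpow_one]
      have h6 : 0 < N ^ (1 / p.toReal) := by positivity
      rw [h5] at h3
      exact le_of_mul_le_mul_right (by rwa [← h5] at h3 ⊢) h6
    calc N = (N ^ (1 / r)) ^ r := by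
          rw [← Real.rpow_mul hN0, one_div, inv_mul_cancel₀ (by linarith), Real.rpow_one]
      _ ≤ C ^ r := Real.rpow_le_rpow (by positivity) h4 (by linarith)

theorem eLpNorm_le_of_pairing_le [Fact (1 ≤ p)] (hp : p ≠ ∞) (hq : q ≠ ∞)
    (hpq : p.toReal.HolderConjugate q.toReal) {h : X → ℂ} {C : ℝ} (hC : 0 ≤ C)
    (H : ∀ φ : X →₀ ℂ, ‖G.pairing φ h‖ ≤ C * ‖G.ccToLp p φ‖) :
    eLpNorm h q G.measure ≤ ENNReal.ofReal C := by
  have hq1 : 0 < q.toReal := hpq.symm.pos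
  have hq0 : q ≠ 0 := fun h => by simp [h] at hq1
  rw [eLpNorm_measure _ hq0 hq, one_div, ENNReal.rpow_inv_le_iff hq1,
    ENNReal.ofReal_rpow_of_nonneg hC hq1.le, ENNReal.tsum_eq_iSup_sum]
  refine iSup_le fun A => ?_
  refine le_of_eq_of_le ?_ (ENNReal.ofReal_le_ofReal (sum_rpow_le_of_pairing_le hp hpq hC H A))
  rw [ENNReal.ofReal_sum_of_nonneg fun x _ => mul_nonneg (G.m_pos x).le (by positivity)]
  refine Finset.sum_congr rfl fun x _ => ?_
  rw [ENNReal.ofReal_mul (G.m_pos x).le, ← ENNReal.ofReal_rpow_of_nonneg (norm_nonneg _) hq1.le,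
    ofReal_norm]

theorem norm_le_of_pairing_le [Fact (1 ≤ p)] [Fact (1 ≤ q)] [p.HolderConjugate q]
    (hp : p ≠ ∞) (hq : q ≠ ∞) {h : G.ell q} {C : ℝ} (hC : 0 ≤ C)
    (H : ∀ φ : X →₀ ℂ, ‖G.pairing φ h‖ ≤ C * ‖G.ccToLp p φ‖) : ‖h‖ ≤ C :=
  ENNReal.toReal_le_of_le_ofReal hC (eLpNorm_le_of_pairing_le hp hq
    (ENNReal.HolderConjugate.toReal_of_ne_top hp hq) hC H)

/-- The adjoints on `ℓ^q` of the bounded operators on `ℓ^p`, for conjugate `p, q ∈ (1, ∞)`. -/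
theorem exists_adjoint (G : MagneticSchrodingerGraph X) [Fact (1 ≤ p)] [Fact (1 ≤ q)]
    [p.HolderConjugate q] (hp : p ≠ ∞) (hq : q ≠ ∞) :
    ∃ C : ℝ, 0 ≤ C ∧ ∀ T : G.ell p →L[ℂ] G.ell p, ∃ T' : G.ell q →L[ℂ] G.ell q,
      ‖T'‖ ≤ C * ‖T‖ ∧ ∀ (f : G.ell p) (g : G.ell q), G.pairing (T f) g = G.pairing f (T' g) := by
  have hpq := ENNReal.HolderConjugate.toReal_of_ne_top hp hq
  obtain ⟨C, hC, hbd⟩ := exists_norm_pairing_le G p q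
  refine ⟨C, hC, fun T => ?_⟩
  -- Testing against δ_x forces this value of the adjoint at x; the converse of Hölder's inequality
  -- then shows that it lies in ℓ^q.
  set k : G.ell q → X → ℂ := fun g x =>
    conj ((G.m x : ℂ)⁻¹ * G.pairing (T (G.ccToLp p (Finsupp.single x 1))) g) with hk
  have hpair : ∀ (φ : X →₀ ℂ) (g : G.ell q),
      G.pairing φ (k g) = G.pairing (T (G.ccToLp p φ)) g := by
    intro φ g
    have h1 : G.pairing φ (k g) = Finsupp.linearCombination ℂ
        (fun x => G.pairing (T (G.ccToLp p (Finsupp.single x 1))) g) φ := by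
      rw [pairing_finsupp_left, Finsupp.linearCombination_apply]
      refine Finsupp.sum_congr fun x _ => ?_
      rw [hk, Complex.conj_conj, mul_inv_cancel_left₀ (m_ne_zero x), smul_eq_mul]
    have h2 : Finsupp.linearCombination ℂ
        (fun x => G.pairing (T (G.ccToLp p (Finsupp.single x 1))) g) =
        (pairingL p g).toLinearMap ∘ₗ T.toLinearMap ∘ₗ G.ccToLpLin p := by
      refine Finsupp.lhom_ext' fun x => LinearMap.ext_ring ?_
      simp [pairingL_apply, ccToLpLin]
    rw [h1, h2, ← pairingL_apply]
    rfl
  have hnorm : ∀ g : G.ell q, eLpNorm (k g) q G.measure ≤ ENNReal.ofReal (C * ‖T‖ * ‖g‖) := by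
    intro g
    refine eLpNorm_le_of_pairing_le hp hq hpq (by positivity) fun φ => ?_
    rw [hpair]
    calc ‖G.pairing (T (G.ccToLp p φ)) g‖ ≤ C * ‖T (G.ccToLp p φ)‖ * ‖g‖ := hbd _ _
      _ ≤ C * (‖T‖ * ‖G.ccToLp p φ‖) * ‖g‖ := by gcongr; exact T.le_opNorm _
      _ = C * ‖T‖ * ‖g‖ * ‖G.ccToLp p φ‖ := by ring
  have hmem : ∀ g : G.ell q, MemLp (k g) q G.measure := fun g =>
    ⟨(Measurable.of_discrete).aestronglyMeasurable, (hnorm g).trans_lt ENNReal.ofReal_lt_top⟩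
  set L : G.ell q →ₗ[ℂ] G.ell q :=
    { toFun := fun g => (hmem g).toLp (k g)
      map_add' := fun g g' => ell_ext fun x => by
        rw [ell_coe_add, coe_toLp, coe_toLp, coe_toLp, hk]
        simp only [pairing_add_right, mul_add, map_add]
      map_smul' := fun a g => ell_ext fun x => by
        rw [RingHom.id_apply, ell_coe_smul, coe_toLp, coe_toLp, hk]
        simp only [pairing_smul_right, map_mul, Complex.conj_conj]
        ring } with hL
  have hLk : ∀ g, ⇑(L g) = k g := fun g => coe_toLp (hmem g)
  refine ⟨L.mkContinuous (C * ‖T‖) fun g => ?_, ?_, fun f g => ?_⟩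
  · exact ENNReal.toReal_le_of_le_ofReal (by positivity) (by rw [hLk]; exact hnorm g)
  · exact L.mkContinuous_norm_le (by positivity) _
  · rw [LinearMap.mkContinuous_apply]
    refine (dense_range_ccToLp hp).induction
      (P := fun f => G.pairing (T f) g = G.pairing f (L g)) ?_ ?_ f
    · rintro _ ⟨φ, rfl⟩
      rw [coe_ccToLp, hLk, hpair]
    · simp only [← pairingL_apply]
      exact isClosed_eq (by fun_prop) (by fun_prop)

end MagneticSchrodingerGraph

/-! ### The formal operator, Green's formula and the closed form -/

namespace MagneticSchrodingerGraph

section Formal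

variable {X : Type*} {G : MagneticSchrodingerGraph X}

theorem finsupp_mem_formalDomain (φ : X →₀ ℂ) : ⇑φ ∈ G.formalDomain := fun x =>
  summable_of_ne_finset_zero (s := φ.support) fun y hy => by simp_all

theorem summable_mul_of_mem_formalDomain {f : X → ℂ} (hf : f ∈ G.formalDomain) (x : X) :
    Summable fun y => (G.b x y : ℂ) * (G.o x y * f y) := by
  refine Summable.of_norm ((hf x).congr fun y => ?_)
  rw [norm_mul, norm_mul, G.o_norm, one_mul, Complex.norm_real,
    Real.norm_of_nonneg (G.b_nonneg x y)]

theorem summable_b_ofReal (G : MagneticSchrodingerGraph X) (x : X) :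
    Summable fun y => (G.b x y : ℂ) :=
  Complex.summable_ofReal.2 (G.b_summable x)

theorem summable_formalOperator {f : X → ℂ} (hf : f ∈ G.formalDomain) (x : X) :
    Summable fun y => (G.b x y : ℂ) * (f x - G.o x y * f y) := by
  simp only [mul_sub]
  exact ((G.summable_b_ofReal x).mul_right (f x)).sub (summable_mul_of_mem_formalDomain hf x)

theorem mul_formalOperator {f : X → ℂ} (x : X) :
    (G.m x : ℂ) * G.formalOperator f x =
      (∑' y, (G.b x y : ℂ) * (f x - G.o x y * f y)) + (G.c x : ℂ) * f x := by
  have := m_ne_zero (G := G) x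
  rw [formalOperator]
  field_simp

theorem mul_formalOperator_eq {f : X → ℂ} (hf : f ∈ G.formalDomain) (x : X) :
    (G.m x : ℂ) * G.formalOperator f x =
      ((∑' y, (G.b x y : ℂ)) + (G.c x : ℂ)) * f x -
        ∑' y, (G.b x y : ℂ) * (G.o x y * f y) := by
  rw [mul_formalOperator]
  simp only [mul_sub]
  rw [Summable.tsum_sub ((G.summable_b_ofReal x).mul_right (f x))
    (summable_mul_of_mem_formalDomain hf x), tsum_mul_right]
  ring

theorem mul_formalOperator_single [DecidableEq X] (x y : X) :
    (G.m y : ℂ) * G.formalOperator (Finsupp.single x 1 : X →₀ ℂ) y =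
      (if y = x then (∑' z, (G.b x z : ℂ)) + (G.c x : ℂ) else 0) -
        (G.b y x : ℂ) * G.o y x := by
  have h1 : ∑' z, (G.b y z : ℂ) * (G.o y z * (Finsupp.single x 1 : X →₀ ℂ) z) =
      (G.b y x : ℂ) * G.o y x := by
    rw [tsum_eq_single x (fun z hz => by rw [Finsupp.single_eq_of_ne hz, mul_zero, mul_zero]),
      Finsupp.single_eq_same, mul_one]
  rw [mul_formalOperator_eq (finsupp_mem_formalDomain _), h1]
  by_cases h : y = x
  · rw [h, if_pos rfl, Finsupp.single_eq_same, mul_one]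
  · rw [if_neg h, Finsupp.single_eq_of_ne h, mul_zero]

/-- Symmetry of b and o(x,y) = conj o(y,x) turn column x of the matrix of 𝓗 into row x. -/
theorem mul_mul_conj_formalOperator_single [DecidableEq X] (f : X → ℂ) (x y : X) :
    (G.m y : ℂ) * f y * conj (G.formalOperator (Finsupp.single x 1 : X →₀ ℂ) y) =
      (if y = x then ((∑' z, (G.b x z : ℂ)) + (G.c x : ℂ)) * f x else 0) -
        (G.b x y : ℂ) * (G.o x y * f y) := by
  have h := congrArg conj (mul_formalOperator_single (G := G) x y)
  rw [map_mul, Complex.conj_ofReal] at h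
  rw [mul_right_comm, h, map_sub, map_mul, ← G.o_symm, Complex.conj_ofReal, G.b_symm y x, sub_mul]
  congr 1
  · split_ifs with hy
    · rw [map_add, Complex.conj_tsum, Complex.conj_ofReal, hy]
      simp only [Complex.conj_ofReal]
    · simp
  · ring

theorem pairing_formalOperator_single {f : X → ℂ} (hf : f ∈ G.formalDomain) (x : X) :
    G.pairing f (G.formalOperator (Finsupp.single x 1 : X →₀ ℂ)) =
      (G.m x : ℂ) * G.formalOperator f x := by
  classical
  rw [pairing, mul_formalOperator_eq hf]
  simp only [mul_mul_conj_formalOperator_single]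
  rw [Summable.tsum_sub _ (summable_mul_of_mem_formalDomain hf x), tsum_ite_eq]
  exact (hasSum_ite_eq x _).summable

/-- For y ≠ x the summand is exactly b(x,y)|f(y)|, and the diagonal term of b vanishes. -/
theorem mem_formalDomain_of_summable {f : X → ℂ}
    (h : ∀ x, Summable fun y =>
      G.m y * ‖f y * conj (G.formalOperator (Finsupp.single x 1 : X →₀ ℂ) y)‖) :
    f ∈ G.formalDomain := by
  classical
  refine fun x => (h x).of_nonneg_of_le
    (fun y => mul_nonneg (G.b_nonneg x y) (norm_nonneg _)) fun y => ?_
  by_cases hy : y = x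
  · rw [hy, G.b_diag, zero_mul]
    exact mul_nonneg (G.m_pos x).le (norm_nonneg _)
  · have h1 := congrArg norm (mul_mul_conj_formalOperator_single (G := G) f x y)
    rw [if_neg hy, zero_sub, norm_neg, mul_assoc, norm_mul, Complex.norm_real,
      Real.norm_of_nonneg (G.m_pos y).le, norm_mul (G.b x y : ℂ), norm_mul (G.o x y), G.o_norm,
      one_mul, Complex.norm_real, Real.norm_of_nonneg (G.b_nonneg x y)] at h1
    exact h1.ge

theorem formalOperator_support (φ : X →₀ ℂ) :
    Function.support (G.formalOperator φ) ⊆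
      φ.support ∪ ⋃ y ∈ φ.support, {x | 0 < G.b y x} := by
  intro x hx
  by_contra h
  simp only [Set.mem_union, Set.mem_iUnion, not_or, not_exists, Finset.mem_coe,
    Finsupp.mem_support_iff, not_not, Set.mem_ofPred_eq, not_lt] at h
  refine hx ?_
  have h1 := mul_formalOperator_eq (finsupp_mem_formalDomain (G := G) φ) x
  have h2 : ∀ y, (G.b x y : ℂ) * (G.o x y * φ y) = 0 := by
    intro y
    by_cases hy : φ y = 0
    · simp [hy]
    · rw [G.b_symm, le_antisymm (h.2 y hy) (G.b_nonneg y x)]; simp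
  simp only [h2, tsum_zero, h.1, mul_zero, sub_zero] at h1
  exact (mul_eq_zero.1 h1).resolve_left (m_ne_zero x)

theorem form_conj (φ ψ : X →₀ ℂ) : conj (G.form φ ψ) = G.form ψ φ := by
  rw [form, form, map_add, map_mul, Complex.conj_tsum, Complex.conj_tsum]
  congr 1
  · congr 1
    · simp [Complex.conj_ofNat]
    · refine tsum_congr fun z => ?_
      simp only [map_mul, Complex.conj_ofReal, Complex.conj_conj]
      ring
  · refine tsum_congr fun z => ?_
    simp only [map_mul, Complex.conj_ofReal, Complex.conj_conj]
    ring

/-- Green's formula. Since o(x,y)o(y,x) = 1, the summand of the form is T(x,y) + T(y,x), and the two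
halves have equal sums, cancelling the factor 1/2. Rearranging is allowed because T has only
finitely many nonzero rows, each absolutely summable. -/
theorem form_eq_pairing (φ ψ : X →₀ ℂ) : G.form φ ψ = G.pairing (G.formalOperator φ) ψ := by
  set T : X × X → ℂ := fun z =>
    (G.b z.1 z.2 : ℂ) * (φ z.1 - G.o z.1 z.2 * φ z.2) * conj (ψ z.1) with hT
  have hrow : ∀ x, Summable fun y => (G.b x y : ℂ) * (φ x - G.o x y * φ y) :=
    summable_formalOperator (finsupp_mem_formalDomain φ)
  have hTs : Summable T := by
    refine Summable.of_norm ?_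
    rw [summable_prod_of_nonneg fun _ => norm_nonneg _]
    refine ⟨fun x => ((hrow x).mul_right (conj (ψ x))).norm, ?_⟩
    refine summable_of_ne_finset_zero (s := ψ.support) fun x hx => ?_
    have : ψ x = 0 := by simpa using hx
    simp [hT, this]
  have hsplit : ∀ z : X × X, (G.b z.1 z.2 : ℂ) * G.magneticDiff φ z.1 z.2 *
      conj (G.magneticDiff ψ z.1 z.2) = T z + T z.swap := by
    rintro ⟨x, y⟩
    have ho : G.o x y * G.o y x = 1 := by
      rw [G.o_symm y x, Complex.mul_conj, Complex.normSq_eq_norm_sq, G.o_norm]; simp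
    simp only [hT, magneticDiff, Prod.fst_swap, Prod.snd_swap, map_sub, map_mul]
    rw [← G.o_symm y x, G.b_symm y x]
    linear_combination (-(G.b x y : ℂ) * φ y * conj (ψ y)) * (-ho)
  have hswap : Summable fun z : X × X => T z.swap :=
    (Equiv.prodComm X X).summable_iff.2 hTs
  have hswap' : ∑' z : X × X, T z.swap = ∑' z, T z := (Equiv.prodComm X X).tsum_eq T
  rw [form, tsum_congr hsplit, Summable.tsum_add hTs hswap, hswap', hTs.tsum_prod, pairing]
  have hfin : ∀ k : X → ℂ, Summable fun x => k x * conj (ψ x) := fun k =>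
    summable_of_ne_finset_zero (s := ψ.support) fun x hx => by
      have : ψ x = 0 := by simpa using hx
      simp [this]
  simp only [mul_formalOperator, add_mul, hT, tsum_mul_right]
  rw [Summable.tsum_add (hfin _) (hfin _)]
  ring

theorem form_add_right (φ ψ ψ' : X →₀ ℂ) :
    G.form φ (ψ + ψ') = G.form φ ψ + G.form φ ψ' := by
  simp only [form_eq_pairing, ← pairing_conj (ψ : X → ℂ), ← pairing_conj (ψ' : X → ℂ),
    ← pairing_conj ((ψ + ψ' : X →₀ ℂ) : X → ℂ), pairing_finsupp_left, ← map_add]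
  rw [Finsupp.sum_add_index' (by simp) (fun _ _ _ => by ring)]

theorem form_smul_right (φ ψ : X →₀ ℂ) (a : ℂ) :
    G.form φ (a • ψ) = conj a * G.form φ ψ := by
  simp only [form_eq_pairing, ← pairing_conj (ψ : X → ℂ),
    ← pairing_conj ((a • ψ : X →₀ ℂ) : X → ℂ), pairing_finsupp_left, ← map_mul]
  rw [Finsupp.sum_smul_index' (by simp), Finsupp.mul_sum]
  simp only [smul_eq_mul, mul_assoc]

/-- The positive form `Q` as a semi-inner product on `C_c(X)`. -/
abbrev formCore (hpos : G.FormPositive) : PreInnerProductSpace.Core ℂ (X →₀ ℂ) where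
  inner φ ψ := G.form ψ φ
  conj_inner_symm φ ψ := form_conj φ ψ
  re_inner_nonneg φ := hpos φ
  add_left φ φ' ψ := form_add_right ψ φ φ'
  smul_left φ ψ a := form_smul_right ψ φ a

theorem norm_form_sq_le (hpos : G.FormPositive) (φ ψ : X →₀ ℂ) :
    ‖G.form φ ψ‖ ^ 2 ≤ G.quadForm φ * G.quadForm ψ := by
  have h := @InnerProductSpace.Core.inner_mul_inner_self_le ℂ (X →₀ ℂ) _ _ _ (formCore hpos) φ ψ
  have h1 : ‖G.form ψ φ‖ * ‖G.form φ ψ‖ ≤ G.quadForm φ * G.quadForm ψ := h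
  rwa [← form_conj φ ψ, RCLike.norm_conj, ← sq] at h1

theorem form_sub_right (φ ψ ψ' : X →₀ ℂ) :
    G.form φ (ψ - ψ') = G.form φ ψ - G.form φ ψ' := by
  rw [eq_sub_iff_add_eq, ← form_add_right, sub_add_cancel]

theorem form_sub_left (φ φ' ψ : X →₀ ℂ) :
    G.form (φ - φ') ψ = G.form φ ψ - G.form φ' ψ := by
  rw [← form_conj ψ, form_sub_right, map_sub, form_conj, form_conj]

theorem form_add_left (φ φ' ψ : X →₀ ℂ) :
    G.form (φ + φ') ψ = G.form φ ψ + G.form φ' ψ := by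
  rw [← form_conj ψ, form_add_right, map_add, form_conj, form_conj]

/-- The parallelogram law, with the nonnegative term Q(φ + ψ) dropped. -/
theorem quadForm_sub_le (hpos : G.FormPositive) (φ ψ : X →₀ ℂ) :
    G.quadForm (φ - ψ) ≤ 2 * G.quadForm φ + 2 * G.quadForm ψ := by
  have h := hpos (φ + ψ)
  simp only [quadForm, form_sub_left, form_sub_right, form_add_left, form_add_right,
    Complex.add_re, Complex.sub_re] at h ⊢
  linarith

theorem tendsto_form_zero (hpos : G.FormPositive) {φ ψ : ℕ → X →₀ ℂ} {M : ℝ}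
    (hφ : Tendsto (fun n => G.quadForm (φ n)) atTop (𝓝 0))
    (hψ : ∀ᶠ n in atTop, G.quadForm (ψ n) ≤ M) :
    Tendsto (fun n => G.form (φ n) (ψ n)) atTop (𝓝 0) := by
  have h1 : Tendsto (fun n => ‖G.form (φ n) (ψ n)‖ ^ 2) atTop (𝓝 0) := by
    refine squeeze_zero' (Eventually.of_forall fun n => by positivity) ?_
      (by simpa using hφ.mul_const M)
    filter_upwards [hψ] with n hn
    exact (norm_form_sq_le hpos _ _).trans (mul_le_mul_of_nonneg_left hn (hpos _))
  rw [tendsto_zero_iff_norm_tendsto_zero]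
  have h2 := h1.sqrt
  simpa [Real.sqrt_sq (norm_nonneg _)] using h2

end Formal

variable {X : Type*} [MeasurableSpace X] [DiscreteMeasurableSpace X]
  {G : MagneticSchrodingerGraph X}

theorem IsFormApprox.eventually_quadForm_le (hpos : G.FormPositive) {φ : ℕ → X →₀ ℂ}
    {f : G.ell 2} (h : G.IsFormApprox φ f) : ∃ M, ∀ᶠ n in atTop, G.quadForm (φ n) ≤ M := by
  obtain ⟨⟨a, b⟩, hab⟩ := eventually_atTop.1 (h.2.eventually (Iio_mem_nhds zero_lt_one))
  refine ⟨2 * 1 + 2 * G.quadForm (-φ b), ?_⟩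
  filter_upwards [eventually_ge_atTop a] with n hn
  have h1 := quadForm_sub_le hpos (φ n - φ b) (-φ b)
  rw [sub_neg_eq_add, sub_add_cancel] at h1
  have h2 : G.quadForm (φ n - φ b) < 1 := hab (n, b) ⟨hn, le_rfl⟩
  linarith

/-- The difference of the two sequences approximates 0, so closability applies to it. -/
theorem IsFormApprox.tendsto_quadForm_sub (hpos : G.FormPositive) (hclos : G.FormClosable)
    {φ φ' : ℕ → X →₀ ℂ} {f : G.ell 2} (h : G.IsFormApprox φ f) (h' : G.IsFormApprox φ' f) :
    Tendsto (fun n => G.quadForm (φ n - φ' n)) atTop (𝓝 0) := by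
  refine hclos (fun n => φ n - φ' n) ⟨?_, ?_⟩
  · have := h.1.sub h'.1
    rw [sub_self] at this
    exact this.congr fun n => (ccToLp_sub _ _).symm
  · refine squeeze_zero (fun k => hpos _) (fun k => ?_)
      (by simpa using (h.2.const_mul 2).add (h'.2.const_mul 2))
    have : φ k.1 - φ' k.1 - (φ k.2 - φ' k.2) = φ k.1 - φ k.2 - (φ' k.1 - φ' k.2) := by abel
    rw [this]
    exact quadForm_sub_le hpos _ _

/-- The two memberships evaluate the closed form along possibly different approximating sequences.
Cauchy–Schwarz and closability show that the limits agree. -/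
theorem inner_eq_of_mem_operatorGraph (hpos : G.FormPositive) (hclos : G.FormClosable)
    {f h g k : G.ell 2} (hf : (f, h) ∈ G.operatorGraph) (hg : (g, k) ∈ G.operatorGraph) :
    inner ℂ h g = inner ℂ f k := by
  obtain ⟨φ, ψ, hφ, hψ, h1⟩ := hf.2 g hg.1
  obtain ⟨ψ', φ', hψ', hφ', h2⟩ := hg.2 f hf.1
  have h3 : Tendsto (fun n => G.form (ψ n) (φ n)) atTop (𝓝 (inner ℂ h g)) := by
    have := (Complex.continuous_conj.tendsto _).comp h1
    simp only [Function.comp_def, form_conj, inner_conj_symm] at this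
    exact this
  obtain ⟨M, hM⟩ := hφ.eventually_quadForm_le hpos
  obtain ⟨M', hM'⟩ := hψ'.eventually_quadForm_le hpos
  have h4 := tendsto_form_zero hpos (hψ.tendsto_quadForm_sub hpos hclos hψ') hM
  have h5 := tendsto_form_zero hpos (hφ.tendsto_quadForm_sub hpos hclos hφ') hM'
  have h6 := (Complex.continuous_conj.tendsto _).comp h5
  simp only [Function.comp_def, form_conj, form_sub_right, map_zero] at h6
  simp only [form_sub_left] at h4
  have h7 := (h3.sub h2).congr' (f₂ := fun n => (G.form (ψ n) (φ n) - G.form (ψ' n) (φ n)) +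
    (G.form (ψ' n) (φ n) - G.form (ψ' n) (φ' n))) (Eventually.of_forall fun n => by ring)
  have h8 := tendsto_nhds_unique h7 (h4.add h6)
  rw [add_zero, sub_eq_zero] at h8
  exact h8

/-- A constant sequence approximates φ; Green's formula and continuity of the inner product give the
limit along any sequence for g. -/
theorem ccToLp_mem_operatorGraph (φ : X →₀ ℂ) (hφ : MemLp (G.formalOperator φ) 2 G.measure) :
    (G.ccToLp 2 φ, hφ.toLp (G.formalOperator φ)) ∈ G.operatorGraph := by
  have happ : G.IsFormApprox (fun _ => φ) (G.ccToLp 2 φ) := by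
    refine ⟨tendsto_const_nhds, ?_⟩
    have h0 : G.quadForm 0 = 0 := by
      have : G.form 0 0 = 0 := by simpa using form_smul_right (G := G) 0 0 0
      rw [quadForm, this, Complex.zero_re]
    simp only [sub_self, h0]
    exact tendsto_const_nhds
  refine ⟨⟨_, happ⟩, ?_⟩
  rintro g ⟨ψ, hψ⟩
  refine ⟨fun _ => φ, ψ, happ, hψ, ?_⟩
  have h1 : ∀ n, inner ℂ (G.ccToLp 2 (ψ n)) (hφ.toLp (G.formalOperator φ)) =
      G.form φ (ψ n) := fun n => by
    rw [inner_eq_pairing, coe_toLp, coe_ccToLp, form_eq_pairing]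
  exact (hψ.1.inner tendsto_const_nhds).congr h1

end MagneticSchrodingerGraph

/-! ### Consistent semigroups and their generators -/

theorem LinearPMap.mem_graph_neg_iff {E : Type*} [NormedAddCommGroup E] [NormedSpace ℂ E]
    {A : E →ₗ.[ℂ] E} {f h : E} : (f, h) ∈ (-A).graph ↔ (f, -h) ∈ A.graph := by
  simp only [LinearPMap.mem_graph_iff]
  constructor
  · rintro ⟨y, hy, h1⟩
    refine ⟨y, hy, ?_⟩
    rw [← h1]
    exact (neg_neg _).symm
  · rintro ⟨y, hy, h1⟩
    refine ⟨y, hy, ?_⟩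
    rw [← neg_neg h]
    exact congrArg Neg.neg h1

namespace MagneticSchrodingerGraph

variable {X : Type*} [MeasurableSpace X] [DiscreteMeasurableSpace X]
  {G : MagneticSchrodingerGraph X} {p q : ℝ≥0∞} {S₂ : ℝ≥0 → G.ell 2 →L[ℂ] G.ell 2}

theorem LocallyFinite.mapsCcInto (hG : G.LocallyFinite) (q : ℝ≥0∞) : G.MapsCcInto q := by
  intro φ
  have hfin : (Function.support (G.formalOperator φ)).Finite :=
    (φ.support.finite_toSet.union (φ.support.finite_toSet.biUnion fun y _ => hG y)).subset
      (formalOperator_support φ)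
  exact ⟨G.memLp_finsupp q (Finsupp.ofSupportFinite _ hfin),
    G.memLp_finsupp 2 (Finsupp.ofSupportFinite _ hfin)⟩

theorem IsSchrodingerSemigroup.inner_generator (hS₂ : G.IsSchrodingerSemigroup S₂)
    (hpos : G.FormPositive) (hclos : G.FormClosable) (f f' g g' : G.ell 2)
    (hf : (f, f') ∈ (semigroupGenerator S₂).graph)
    (hg : (g, g') ∈ (semigroupGenerator S₂).graph) : inner ℂ f' g = inner ℂ f g' := by
  have key : ∀ f f' : G.ell 2, (f, f') ∈ (semigroupGenerator S₂).graph →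
      (f, -f') ∈ G.operatorGraph := fun f f' h => by
    rw [← hS₂.2, LinearPMap.mem_graph_neg_iff, neg_neg]
    exact h
  have := inner_eq_of_mem_operatorGraph hpos hclos (key _ _ hf) (key _ _ hg)
  rwa [inner_neg_left, inner_neg_right, neg_inj] at this

theorem IsSchrodingerSemigroup.pairing_apply (hS₂ : G.IsSchrodingerSemigroup S₂)
    (hpos : G.FormPositive) (hclos : G.FormClosable) (t : ℝ≥0) (f g : G.ell 2) :
    G.pairing (S₂ t f) g = G.pairing f (S₂ t g) := by
  rw [← inner_eq_pairing, ← inner_eq_pairing]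
  exact (hS₂.1.inner_apply_left (hS₂.inner_generator hpos hclos) t g f).symm

theorem IsSchrodingerSemigroup.ccToLp_mem_graph (hS₂ : G.IsSchrodingerSemigroup S₂) (φ : X →₀ ℂ)
    (hφ : MemLp (G.formalOperator φ) 2 G.measure) :
    (G.ccToLp 2 φ, -hφ.toLp (G.formalOperator φ)) ∈ (semigroupGenerator S₂).graph := by
  rw [← LinearPMap.mem_graph_neg_iff, hS₂.2]
  exact ccToLp_mem_operatorGraph φ hφ

section Consistent

variable [Fact (1 ≤ p)] {S : ℝ≥0 → G.ell p →L[ℂ] G.ell p}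

/-- Evaluation at a point is continuous on both spaces and commutes with the integral, so
consistency passes to integrated orbits. -/
theorem IsConsistentSemigroup.integral_orbit_eq (hS : G.IsConsistentSemigroup S₂ p S)
    (hS₂ : IsC0Semigroup S₂) {f : G.ell 2} {g : G.ell p}
    (hfg : ∀ x, (f : X → ℂ) x = (g : X → ℂ) x) (t : ℝ) (x : X) :
    ((∫ s in (0 : ℝ)..t, semigroupOrbit S₂ f s : G.ell 2) : X → ℂ) x =
      ((∫ s in (0 : ℝ)..t, semigroupOrbit S g s : G.ell p) : X → ℂ) x := by
  obtain ⟨L, hL⟩ := exists_eval G 2 x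
  obtain ⟨L', hL'⟩ := exists_eval G p x
  rw [← hL, ← hL', ← ContinuousLinearMap.intervalIntegral_comp_comm _
    ((hS₂.continuous_semigroupOrbit f).intervalIntegrable _ _),
    ← ContinuousLinearMap.intervalIntegral_comp_comm _
    ((hS.1.continuous_semigroupOrbit g).intervalIntegrable _ _)]
  refine intervalIntegral.integral_congr fun s _ => ?_
  simp only [hL, hL', semigroupOrbit]
  exact hS.2 _ f g hfg x

/-- The integral formula for φ holds in ℓ^2, transfers pointwise to ℓ^p, and is differentiated there
at 0. -/
theorem IsConsistentSemigroup.ccToLp_mem_graph (hS : G.IsConsistentSemigroup S₂ p S)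
    (hS₂ : G.IsSchrodingerSemigroup S₂) (φ : X →₀ ℂ)
    (hφp : MemLp (G.formalOperator φ) p G.measure)
    (hφ2 : MemLp (G.formalOperator φ) 2 G.measure) :
    (G.ccToLp p φ, -hφp.toLp (G.formalOperator φ)) ∈ (semigroupGenerator S).graph := by
  rw [mem_graph_semigroupGenerator]
  refine hS.1.tendsto_quotient_of_integral fun t ht => ell_ext fun x => ?_
  have h1 := hS₂.1.orbit_sub_eq_integral
    (mem_graph_semigroupGenerator.1 (hS₂.ccToLp_mem_graph φ hφ2)) ht
  have h2 : ((semigroupOrbit S₂ (G.ccToLp 2 φ) t : G.ell 2) : X → ℂ) x =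
      ((semigroupOrbit S (G.ccToLp p φ) t : G.ell p) : X → ℂ) x := hS.2 _ _ _ (fun x => by simp) x
  have h3 := hS.integral_orbit_eq hS₂.1 (f := -hφ2.toLp (G.formalOperator φ))
    (g := -hφp.toLp (G.formalOperator φ))
    (fun y => by rw [ell_coe_neg, ell_coe_neg, coe_toLp, coe_toLp]) t x
  refine Eq.trans ?_ ((congrArg (fun k : G.ell 2 => (k : X → ℂ) x) h1).trans h3)
  rw [ell_coe_sub, ell_coe_sub, h2, coe_ccToLp, coe_ccToLp]

theorem IsConsistentSemigroup.ccToLp_mem_domain (hS : G.IsConsistentSemigroup S₂ p S)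
    (hS₂ : G.IsSchrodingerSemigroup S₂) (φ : X →₀ ℂ)
    (hφ : MemLp (G.formalOperator φ) p G.measure ∧ MemLp (G.formalOperator φ) 2 G.measure) :
    G.ccToLp p φ ∈ (-semigroupGenerator S).domain :=
  show _ ∈ (semigroupGenerator S).domain from
    LinearPMap.mem_domain_of_mem_graph (hS.ccToLp_mem_graph hS₂ φ hφ.1 hφ.2)

variable [Fact (1 ≤ q)] [p.HolderConjugate q]

theorem IsConsistentSemigroup.pairing_apply_sub (hS : G.IsConsistentSemigroup S₂ p S)
    (hS₂ : G.IsSchrodingerSemigroup S₂) (hpos : G.FormPositive) (hclos : G.FormClosable)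
    (hp : p ≠ ∞) (φ : X →₀ ℂ) (hφq : MemLp (G.formalOperator φ) q G.measure)
    (hφ2 : MemLp (G.formalOperator φ) 2 G.measure) (f : G.ell p) (t : ℝ≥0) :
    G.pairing (S t f - f : G.ell p) φ =
      -G.pairing (∫ s in (0 : ℝ)..t, semigroupOrbit S f s : G.ell p) (G.formalOperator φ) := by
  refine (dense_range_ccToLp hp).induction (P := fun f => G.pairing (S t f - f : G.ell p) φ =
    -G.pairing (∫ s in (0 : ℝ)..t, semigroupOrbit S f s : G.ell p) (G.formalOperator φ)) ?_ ?_ f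
  · rintro _ ⟨ψ, rfl⟩
    -- The integrated orbit of ψ lies in D(H_2), with generator value S₂(t)ψ - ψ, so symmetry
    -- against φ gives the identity.
    have h1 := hS₂.inner_generator hpos hclos _ _ _ _
      (hS₂.ccToLp_mem_graph φ hφ2)
      (mem_graph_semigroupGenerator.2
        (hS₂.1.tendsto_quotient_integral (G.ccToLp 2 ψ) t.2))
    rw [inner_neg_left, inner_eq_pairing, inner_eq_pairing, coe_toLp, coe_ccToLp] at h1
    have h2 : ((∫ s in (0 : ℝ)..t, semigroupOrbit S₂ (G.ccToLp 2 ψ) s : G.ell 2) : X → ℂ) =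
        ((∫ s in (0 : ℝ)..t, semigroupOrbit S (G.ccToLp p ψ) s : G.ell p) : X → ℂ) :=
      funext (hS.integral_orbit_eq hS₂.1 (fun x => by simp) t)
    have h3 : ((semigroupOrbit S₂ (G.ccToLp 2 ψ) t - G.ccToLp 2 ψ : G.ell 2) : X → ℂ) =
        ((S t (G.ccToLp p ψ) - G.ccToLp p ψ : G.ell p) : X → ℂ) := by
      funext x
      rw [ell_coe_sub, ell_coe_sub, semigroupOrbit, Real.toNNReal_coe,
        hS.2 t (G.ccToLp 2 ψ) (G.ccToLp p ψ) (fun x => by simp), coe_ccToLp, coe_ccToLp]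
    rw [← h2, ← h3]
    exact h1.symm
  · have h1 : ∀ h : G.ell p, G.pairing h φ = pairingL p (G.ccToLp q φ) h := fun h => by
      rw [pairingL_apply, coe_ccToLp]
    have h2 : ∀ h : G.ell p, G.pairing h (G.formalOperator φ) =
        pairingL p (hφq.toLp (G.formalOperator φ)) h := fun h => by
      rw [pairingL_apply, coe_toLp]
    simp only [h1, h2]
    have := hS.1.continuous_integral_orbit t
    exact isClosed_eq (by fun_prop) (by fun_prop)

theorem IsConsistentSemigroup.pairing_generator (hS : G.IsConsistentSemigroup S₂ p S)
    (hS₂ : G.IsSchrodingerSemigroup S₂) (hpos : G.FormPositive) (hclos : G.FormClosable)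
    (hp : p ≠ ∞) (φ : X →₀ ℂ) (hφq : MemLp (G.formalOperator φ) q G.measure)
    (hφ2 : MemLp (G.formalOperator φ) 2 G.measure) {f h : G.ell p}
    (hf : (f, h) ∈ (-semigroupGenerator S).graph) :
    G.pairing h φ = G.pairing f (G.formalOperator φ) := by
  rw [LinearPMap.mem_graph_neg_iff, mem_graph_semigroupGenerator,
    hS.1.tendsto_quotient_iff] at hf
  set L := (pairingL p (G.ccToLp q φ)).restrictScalars ℝ with hL
  set K := (pairingL p (hφq.toLp (G.formalOperator φ))).restrictScalars ℝ with hK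
  have hLa : ∀ k : G.ell p, L k = G.pairing k φ := fun k => by
    rw [hL, ContinuousLinearMap.coe_restrictScalars', pairingL_apply, coe_ccToLp]
  have hKa : ∀ k : G.ell p, K k = G.pairing k (G.formalOperator φ) := fun k => by
    rw [hK, ContinuousLinearMap.coe_restrictScalars', pairingL_apply, coe_toLp]
  have h1 : HasDerivWithinAt (fun t => L (semigroupOrbit S f t - f)) (L (-h)) (Set.Ici 0) 0 :=
    L.hasFDerivAt.comp_hasDerivWithinAt 0 (hf.sub_const f)
  have h2 : HasDerivWithinAt (fun t => -K (∫ s in (0 : ℝ)..t, semigroupOrbit S f s)) (-K f)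
      (Set.Ici 0) 0 := by
    have h3 := hS.1.hasDerivAt_integral_orbit f 0
    rw [hS.1.semigroupOrbit_zero] at h3
    exact (K.hasFDerivAt.comp_hasDerivWithinAt 0 h3.hasDerivWithinAt).neg
  have h4 : ∀ t ∈ Set.Ici (0 : ℝ), L (semigroupOrbit S f t - f) =
      -K (∫ s in (0 : ℝ)..t, semigroupOrbit S f s) := by
    intro t ht
    have := hS.pairing_apply_sub hS₂ hpos hclos hp φ hφq hφ2 f t.toNNReal
    rw [Real.coe_toNNReal t ht] at this
    rw [hLa, hKa, ← this, semigroupOrbit]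
  -- The two sides of the integrated identity have the same right derivative at 0.
  have h5 := (uniqueDiffWithinAt_Ici (0 : ℝ)).eq_deriv _ h1
    (h2.congr h4 (h4 0 Set.self_mem_Ici))
  rw [map_neg, neg_inj, hLa, hKa] at h5
  exact h5

/-- The semigroup law and consistency dualize; the latter because `S₂` is symmetric. Strong
continuity needs a norm estimate on C_c(X), and this is where 𝓗φ ∈ ℓ^q enters. -/
theorem IsConsistentSemigroup.exists_adjoint (hS : G.IsConsistentSemigroup S₂ p S)
    (hS₂ : G.IsSchrodingerSemigroup S₂) (hpos : G.FormPositive) (hclos : G.FormClosable)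
    (hp : p ≠ ∞) (hq : q ≠ ∞) (hcc : G.MapsCcInto q) :
    ∃ S' : ℝ≥0 → G.ell q →L[ℂ] G.ell q, G.IsConsistentSemigroup S₂ q S' := by
  obtain ⟨C, hC, hT⟩ := MagneticSchrodingerGraph.exists_adjoint G (p := p) hp hq
  obtain ⟨C', hC', hbd⟩ := exists_norm_pairing_le G p q
  choose T hTn hTp using hT
  refine ⟨fun t => T (S t), IsC0Semigroup.of_dense ?_ ?_ ?_ (dense_range_ccToLp hq) ?_, ?_⟩
  · ext1 g
    refine ell_ext fun x => congrFun (eq_of_pairing_left (G := G) fun φ => ?_) x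
    rw [← coe_ccToLp (p := p), ← hTp, hS.1.map_zero]
    rfl
  · intro s t
    ext1 g
    refine ell_ext fun x => congrFun (eq_of_pairing_left (G := G) fun φ => ?_) x
    rw [← coe_ccToLp (p := p), ← hTp, ContinuousLinearMap.comp_apply, ← hTp, ← hTp, add_comm,
      hS.1.map_add]
    rfl
  · intro t₀
    obtain ⟨M, hM⟩ := hS.1.exists_norm_le t₀
    exact ⟨C * M, fun t ht => (hTn _).trans (mul_le_mul_of_nonneg_left (hM t ht) hC)⟩
  · rintro _ ⟨φ, rfl⟩
    obtain ⟨M, hM⟩ := hS.1.exists_norm_le 1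
    have hM0 : 0 ≤ M := (norm_nonneg _).trans (hM 0 zero_le)
    obtain ⟨hφq, hφ2⟩ := hcc φ
    set K := ‖hφq.toLp (G.formalOperator φ)‖ with hK
    have hlim : Tendsto (fun t : ℝ≥0 => C' * M * K * (t : ℝ)) (𝓝 0) (𝓝 0) := by
      have := (NNReal.continuous_coe.tendsto 0).const_mul (C' * M * K)
      simpa using this
    rw [tendsto_iff_norm_sub_tendsto_zero]
    refine squeeze_zero' (Eventually.of_forall fun _ => norm_nonneg _) ?_ hlim
    filter_upwards [Iic_mem_nhds (zero_lt_one (α := ℝ≥0))] with t ht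
    -- By duality it suffices to bound ⟨S(t)ψ - ψ, φ⟩, which the integrated identity makes of order
    -- t.
    refine norm_le_of_pairing_le hp hq (by positivity) fun ψ => ?_
    have h1 : G.pairing ψ (T (S t) (G.ccToLp q φ) - G.ccToLp q φ : G.ell q) =
        G.pairing (S t (G.ccToLp p ψ) - G.ccToLp p ψ : G.ell p) φ := by
      rw [← coe_ccToLp (p := p), pairing_sub_right, ← hTp, ← pairing_sub_left, coe_ccToLp]
    rw [h1, hS.pairing_apply_sub hS₂ hpos hclos hp φ hφq hφ2, norm_neg, ← coe_toLp hφq]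
    refine (hbd _ _).trans ?_
    calc C' * ‖∫ s in (0 : ℝ)..t, semigroupOrbit S (G.ccToLp p ψ) s‖ * K
        ≤ C' * (M * ‖G.ccToLp p ψ‖ * t) * K := by
          gcongr
          exact IsC0Semigroup.norm_integral_orbit_le hM ht _
      _ = C' * M * K * t * ‖G.ccToLp p ψ‖ := by ring
  · intro t f g hfg
    refine congrFun (eq_of_pairing_left (G := G) fun φ => ?_)
    have h1 : ((S₂ t (G.ccToLp 2 φ) : G.ell 2) : X → ℂ) = S t (G.ccToLp p φ) :=
      funext (hS.2 t _ _ fun x => by simp)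
    rw [← coe_ccToLp (p := 2), ← hS₂.pairing_apply hpos hclos, h1, funext hfg, hTp, coe_ccToLp,
      coe_ccToLp]

/-- The adjoint relation is a linear subspace; density of the domain of `H₁` makes it single-valued.
-/
theorem exists_isAdjointOfL1 {H₁ : G.ell 1 →ₗ.[ℂ] G.ell 1} (hH₁ : Dense (H₁.domain : Set (G.ell 1)))
    [ENNReal.HolderConjugate 1 q] : ∃ H : G.ell q →ₗ.[ℂ] G.ell q, G.IsAdjointOfL1 q H₁ H := by
  set Γ : Submodule ℂ (G.ell q × G.ell q) :=
    { carrier := {k | ∀ g : H₁.domain, G.pairing (H₁ g) k.1 = G.pairing (g : G.ell 1) k.2}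
      zero_mem' := fun g => by
        have h1 : ∀ f : G.ell 1, G.pairing f (0 : G.ell q) = 0 := fun f => by
          simpa using pairing_sub_right f (0 : G.ell q) 0
        exact (h1 _).trans (h1 _).symm
      add_mem' := fun {k k'} hk hk' g => by
        rw [Prod.fst_add, Prod.snd_add, pairing_add_right, pairing_add_right, hk g, hk' g]
      smul_mem' := fun a k hk g => by
        rw [Prod.smul_fst, Prod.smul_snd, pairing_smul_right, pairing_smul_right, hk g] } with hΓ
  refine ⟨Γ.toLinearPMap, fun f h => ?_⟩
  rw [Submodule.toLinearPMap_graph_eq]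
  · rfl
  · rintro ⟨f, h⟩ hk hf
    simp only at hf ⊢
    subst hf
    -- Here h - h plays the role of zero, so that `pairing_sub_right` evaluates the pairing.
    have h1 : ∀ g : G.ell 1, G.pairing g (h - h : G.ell q) = G.pairing g h := by
      intro g
      refine hH₁.induction (P := fun g : G.ell 1 =>
        G.pairing g (h - h : G.ell q) = G.pairing g h) ?_ ?_ g
      · intro g hg
        have h2 := hk ⟨g, hg⟩
        have h3 := pairing_sub_right (H₁ ⟨g, hg⟩) (0 : G.ell q) 0
        rw [sub_self, sub_self] at h3
        rw [pairing_sub_right, sub_self]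
        exact h3.symm.trans h2
      · simp only [← pairingL_apply]
        exact isClosed_eq (by fun_prop) (by fun_prop)
    refine ell_ext fun x => ?_
    have h2 : ((h - h : G.ell q) : X → ℂ) = h := eq_of_pairing_left (G := G) fun φ => by
      rw [← coe_ccToLp (p := 1)]
      exact h1 _
    rw [← h2, sub_self]

end Consistent

/-- Testing with δ_x suffices: Hölder's inequality gives the summability, Green's formula the value
at x. As p = ∞ is allowed, both cases of the theorem use it. -/
theorem mem_formalDomain_and_eq_formalOperator [p.HolderConjugate q] (hcc : G.MapsCcInto q)
    {f h : G.ell p}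
    (H : ∀ φ : X →₀ ℂ, G.pairing h φ = G.pairing f (G.formalOperator φ)) :
    (f : X → ℂ) ∈ G.formalDomain ∧ ∀ x, (h : X → ℂ) x = G.formalOperator f x := by
  have hf : (f : X → ℂ) ∈ G.formalDomain := mem_formalDomain_of_summable fun x => by
    have := summable_norm_of_integrable (integrable_mul_conj f
      ((hcc (Finsupp.single x 1)).1.toLp _))
    simpa only [coe_toLp] using this
  refine ⟨hf, fun x => ?_⟩
  have h1 := H (Finsupp.single x 1)
  rw [pairing_single_right, pairing_formalOperator_single hf] at h1
  exact mul_left_cancel₀ (m_ne_zero x) h1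

end MagneticSchrodingerGraph

end

/-! ### The theorem: finite and infinite exponents -/

theorem theorem3p8 {X : Type*} [MeasurableSpace X] [DiscreteMeasurableSpace X]
    (G : MagneticSchrodingerGraph X) (hpos : G.FormPositive) (hclos : G.FormClosable)
    (S₂ : ℝ≥0 → G.ell 2 →L[ℂ] G.ell 2) (hS₂ : G.IsSchrodingerSemigroup S₂)
    (p q : ℝ≥0∞) [Fact (1 ≤ p)] [Fact (1 ≤ q)] (hpq : p.HolderConjugate q) :
    (G.LocallyFinite → G.MapsCcInto q) ∧
    (G.MapsCcInto q →
      ∀ Hp : G.ell p →ₗ.[ℂ] G.ell p, G.IsLpGenerator S₂ p Hp →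
        (∀ f : Hp.domain,
          ((f : G.ell p) : X → ℂ) ∈ G.formalDomain ∧
            ∀ x, (Hp f : X → ℂ) x = G.formalOperator (f : G.ell p) x) ∧
        (∃ Hq : G.ell q →ₗ.[ℂ] G.ell q, G.IsLpGenerator S₂ q Hq) ∧
        (∀ Hq : G.ell q →ₗ.[ℂ] G.ell q, G.IsLpGenerator S₂ q Hq →
          ∀ φ : X →₀ ℂ, G.ccToLp q φ ∈ Hq.domain)) := by
  have := hpq
  have := hpq.symm
  refine ⟨fun hG => hG.mapsCcInto q, fun hcc Hp hHp => ?_⟩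
  rcases hHp with ⟨hp, S, hS, rfl⟩ | ⟨hp, H₁, ⟨S, hS, rfl⟩, hadj⟩
  · have hgen : ∀ (φ : X →₀ ℂ) (f : (-semigroupGenerator S).domain),
        G.pairing ((-semigroupGenerator S) f) φ =
          G.pairing (f : G.ell p) (G.formalOperator φ) := fun φ f =>
      hS.pairing_generator hS₂ hpos hclos hp φ (hcc φ).1 (hcc φ).2 (LinearPMap.mem_graph _ f)
    refine ⟨fun f => MagneticSchrodingerGraph.mem_formalDomain_and_eq_formalOperator hcc
      fun φ => hgen φ f, ?_, ?_⟩
    · by_cases hq : q = ∞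
      · have hp1 : p = 1 := (ENNReal.HolderConjugate.eq_top_iff_eq_one q p).1 hq
        subst hp1
        obtain ⟨H, hH⟩ := MagneticSchrodingerGraph.exists_isAdjointOfL1 (q := q)
          (H₁ := -semigroupGenerator S) hS.1.dense_domain
        exact ⟨H, Or.inr ⟨hq, _, ⟨S, hS, rfl⟩, hH⟩⟩
      · obtain ⟨S', hS'⟩ := hS.exists_adjoint hS₂ hpos hclos hp hq hcc
        exact ⟨_, Or.inl ⟨hq, S', hS', rfl⟩⟩
    · rintro Hq (⟨-, S', hS', rfl⟩ | ⟨hq, H₁, ⟨S', hS', rfl⟩, hadj⟩) φ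
      · exact hS'.ccToLp_mem_domain hS₂ φ (hcc φ)
      · have hp1 : p = 1 := (ENNReal.HolderConjugate.eq_top_iff_eq_one q p).1 hq
        subst hp1
        refine LinearPMap.mem_domain_of_mem_graph
          -- The witness for H_∞φ is 𝓗φ; the adjoint relation is then the differentiated identity
          -- for H_1.
          ((hadj _ ((hcc φ).1.toLp (G.formalOperator φ))).2 fun g => ?_)
        rw [MagneticSchrodingerGraph.coe_toLp, MagneticSchrodingerGraph.coe_ccToLp]
        exact hS'.pairing_generator hS₂ hpos hclos ENNReal.one_ne_top φ (hcc φ).1 (hcc φ).2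
          (LinearPMap.mem_graph _ g)
  · have hq : q = 1 := (ENNReal.HolderConjugate.eq_top_iff_eq_one p q).1 hp
    subst hq
    refine ⟨fun f => MagneticSchrodingerGraph.mem_formalDomain_and_eq_formalOperator hcc
      fun φ => ?_, ⟨_, Or.inl ⟨ENNReal.one_ne_top, S, hS, rfl⟩⟩, ?_⟩
    -- Since φ ∈ D(H_1) with H_1φ = 𝓗φ, the adjoint relation at φ is the required one up to
    -- conjugation.
    · have hφ := hS.ccToLp_mem_graph hS₂ φ (hcc φ).1 (hcc φ).2
      rw [← LinearPMap.mem_graph_neg_iff, LinearPMap.mem_graph_iff] at hφ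
      obtain ⟨y, hy, hy'⟩ := hφ
      have h1 := (hadj _ _).1 (LinearPMap.mem_graph Hp f) y
      rw [hy, hy', MagneticSchrodingerGraph.coe_toLp, MagneticSchrodingerGraph.coe_ccToLp] at h1
      rw [← MagneticSchrodingerGraph.pairing_conj, ← h1,
        MagneticSchrodingerGraph.pairing_conj]
    · rintro Hq (⟨-, S', hS', rfl⟩ | ⟨hq, -⟩) φ
      · exact hS'.ccToLp_mem_domain hS₂ φ (hcc φ)
      · exact absurd hq ENNReal.one_ne_top
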